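/- Let $X$ be a finite poset and $x_0\in X$. *Discrete homotopy.* Order $\mathbb Z$ by $2i<2i+1$ and $2i<2i-1$ for all $i$ (no other strict relations). A loop is an order-preserving map $f:\mathbb Z\to X$ for which some integer $r\ge 0$ satisfies $f(t)=x_0$ whenever $|t|\ge r$; the least such $r$ is its radius $r_f$. Loops $f,g$ are homotopic if, for some $p\ge 0$, there is an order-preserving $H:\mathbb Z\times\{0,\dots,p\}\to X$ (with $\{0,\dots,p\}\subset\mathbb Z$ carrying the induced order) such that every $H(\cdot,i)$ is a loop, $H(\cdot,0)=f$ and $H(\cdot,p)=g$. The set $\pi_1^D(X,x_0)$ of homotopy classes is a group under $[f][g]=[f\cdot g]$, where $(f\cdot g)(t)=f(t)$ for $t\le r_f$ and $(f\cdot g)(t)=g(t-s)$ for $t>r_f$, $s$ being the least even integer with $s\ge r_f+r_g$. *Discrete cubical homology.* An $n$-cube of $X$ is an order-preserving map $\sigma:\{0<1\}^n\to X$; $f_i^-\sigma$ and $f_i^+\sigma$ are its faces obtained by setting the $i$-th coordinate to $0$ and $1$, and $\sigma$ is degenerate if $f_i^-\sigma=f_i^+\sigma$ for some $i$. Let $C_n(X)$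 be the free abelian group on all $n$-cubes modulo the subgroup generated by the degenerate ones, with boundary $\partial\sigma=\sum_{i=1}^n(-1)^i(f_i^-\sigma-f_i^+\sigma)$, and let $H_n^{\rm Cube}(X)$ be the $n$-th homology group of the complex $C_*(X)$. *Discrete Hurewicz map.* For a loop $f$ of radius $r$ let $T_rf(t)=f(t-2r)$ for $0\le t\le 4r$, and let $h^D([f])\in H_1^{\rm Cube}(X)$ be the class of $$\sum_{t=0}^{4r-1}\varepsilon_t,$$ where $\varepsilon_t$ is the $1$-cube $(T_rf(t)\le T_rf(t+1))$ if $t$ is even, and minus the $1$-cube $(T_rf(t+1)\le T_rf(t))$ if $t$ is odd. This is a well-defined group homomorphism $h^D:\pi_1^D(X,x_0)\to H_1^{\rm Cube}(X)$. **Theorem.** For every finite poset $X$ and every $x_0\in X$, the kernel of $h^D:\pi_1^D(X,x_0)\to H_1^{\rm Cube}(X)$ is the commutator subgroup $[\pi_1^D(X,x_0),\pi_1^D(X,x_0)]$. If moreover $X$ is connected (as a finite $T_0$ space whose open sets are the lower sets; equivalently, any two elements are joined by a chain of successively comparable elements), then $h^D$ is surjective, so that $h^D$ induces an isomorphism from the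 abelianization of $\pi_1^D(X,x_0)$ onto $H_1^{\rm Cube}(X)$. -/

import Mathlib

namespace PosetHurewicz

/-! ### The integers as a poset -/

/-- The integers with the zigzag order `⋯ > -2 < -1 > 0 < 1 > 2 < ⋯`: the poset whose
Hasse diagram has the edges `(2i, 2i+1)` and `(2j, 2j-1)`. -/
@[ext] structure Zigzag where
  val : ℤ

namespace Zigzag

instance : PartialOrder Zigzag where
  le a b := a = b ∨ (Even a.val ∧ (b.val = a.val + 1 ∨ b.val = a.val - 1))
  le_refl a := Or.inl rfl
  le_trans a b c := by
    rintro (rfl | ⟨h1, h2⟩) (rfl | ⟨h3, h4⟩)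
    · exact Or.inl rfl
    · exact Or.inr ⟨h3, h4⟩
    · exact Or.inr ⟨h1, h2⟩
    · exfalso
      rw [Int.even_iff] at h1 h3
      omega
  le_antisymm a b := by
    rintro (rfl | ⟨h1, h2⟩) (h | ⟨h3, h4⟩)
    · rfl
    · rfl
    · exact h.symm
    · exfalso
      rw [Int.even_iff] at h1 h3
      omega

theorem le_def (a b : Zigzag) :
    a ≤ b ↔ a = b ∨ (Even a.val ∧ (b.val = a.val + 1 ∨ b.val = a.val - 1)) := Iff.rfl

theorem even_le_succ {x : ℤ} (h : Even x) : (⟨x⟩ : Zigzag) ≤ ⟨x + 1⟩ := Or.inr ⟨h, Or.inl rfl⟩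

theorem odd_succ_le {x : ℤ} (h : ¬ Even x) : (⟨x + 1⟩ : Zigzag) ≤ ⟨x⟩ := by
  refine Or.inr ⟨?_, Or.inr ?_⟩
  · simp only [Int.even_iff] at *
    omega
  · simp

theorem monotone_of_step {X : Type*} [Preorder X] {f : Zigzag → X}
    (h : ∀ x : ℤ, (Even x → f ⟨x⟩ ≤ f ⟨x + 1⟩) ∧ (¬ Even x → f ⟨x + 1⟩ ≤ f ⟨x⟩)) :
    Monotone f := by
  rintro ⟨a⟩ ⟨b⟩ hab
  rcases hab with hab | ⟨h1, h2⟩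
  · rw [hab]
  · simp only at h1 h2
    rcases h2 with rfl | rfl
    · exact (h a).1 h1
    · have := (h (a - 1)).2 (by rw [Int.even_iff] at *; omega)
      simpa using this

theorem comparable_succ {X : Type*} [Preorder X] (f : Zigzag →o X) (x : ℤ) :
    (Even x → f ⟨x⟩ ≤ f ⟨x + 1⟩) ∧ (¬ Even x → f ⟨x + 1⟩ ≤ f ⟨x⟩) :=
  ⟨fun h => f.monotone (even_le_succ h), fun h => f.monotone (odd_succ_le h)⟩

/-- The subposet `{0, …, p}` of the zigzag poset. -/
abbrev Seg (p : ℕ) : Type := {t : Zigzag // 0 ≤ t.val ∧ t.val ≤ p}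

/-- The first point of `Seg p`. -/
def Seg.first (p : ℕ) : Seg p := ⟨⟨0⟩, le_refl _, Int.natCast_nonneg p⟩

/-- The last point of `Seg p`. -/
def Seg.last (p : ℕ) : Seg p := ⟨⟨p⟩, Int.natCast_nonneg p, le_refl _⟩

/-- Translation by an even integer, `t ↦ t - s`. -/
def translate (s : ℤ) (hs : Even s) : Zigzag →o Zigzag where
  toFun t := ⟨t.val - s⟩
  monotone' := monotone_of_step fun x => by
    constructor
    · intro h
      refine Or.inr ⟨h.sub hs, Or.inl ?_⟩
      simp only
      ring
    · intro h
      refine Or.inr ⟨?_, Or.inr ?_⟩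
      · simp only [Int.even_iff] at *
        omega
      · simp only
        ring

end Zigzag

/-! ### Loops, homotopies, and the first discrete homotopy group -/

variable {X : Type*} [PartialOrder X] {x₀ : X}

/-- The value of `f` is `x₀` at every integer of absolute value at least `r`. -/
def ConstOutside (x₀ : X) (f : Zigzag → X) (r : ℕ) : Prop :=
  ∀ t : Zigzag, (r : ℤ) ≤ |t.val| → f t = x₀

/-- A map `(ℤ, ∂ℤ) → (X, x₀)`: an order-preserving map from the zigzag poset to `X` that
takes the value `x₀` outside a bounded set. -/
structure Loop (X : Type*) [PartialOrder X] (x₀ : X) where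
  toHom : Zigzag →o X
  bounded : ∃ r : ℕ, ConstOutside x₀ toHom r

namespace Loop

instance : CoeFun (Loop X x₀) (fun _ => Zigzag → X) := ⟨fun f => f.toHom⟩

theorem ext_of {f g : Loop X x₀} (h : ∀ t, f t = g t) : f = g := by
  cases f; cases g
  congr
  exact OrderHom.ext _ _ (funext h)

/-- The radius of a loop: the least `r` for which the loop is `x₀` at all `t` with `r ≤ |t|`. -/
noncomputable def radius (f : Loop X x₀) : ℕ := sInf {r : ℕ | ConstOutside x₀ f r}

theorem radius_spec (f : Loop X x₀) : ConstOutside x₀ f f.radius :=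
  Nat.sInf_mem (s := {r : ℕ | ConstOutside x₀ f r}) f.bounded

theorem eq_of_ge (f : Loop X x₀) {t : Zigzag} (h : (f.radius : ℤ) ≤ t.val) : f t = x₀ :=
  f.radius_spec t (h.trans (le_abs_self _))

theorem eq_of_le (f : Loop X x₀) {t : Zigzag} (h : t.val ≤ -(f.radius : ℤ)) : f t = x₀ :=
  f.radius_spec t (le_trans (by linarith) (neg_le_abs _))

/-- Two loops are homotopic if some order-preserving `H : ℤ × {0, …, p} → X` has the one as its
first and the other as its last level, and every level of `H` is a loop at `x₀`. -/
def Homotopic (f g : Loop X x₀) : Prop :=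
  ∃ (p : ℕ) (H : Zigzag × Zigzag.Seg p →o X),
    (∀ i : Zigzag.Seg p, ∃ r : ℕ, ConstOutside x₀ (fun t => H (t, i)) r) ∧
    (∀ t, H (t, Zigzag.Seg.first p) = f t) ∧
    (∀ t, H (t, Zigzag.Seg.last p) = g t)

/-- Pointwise comparability of loops. -/
def Comp (f g : Loop X x₀) : Prop := (∀ t, f t ≤ g t) ∨ (∀ t, g t ≤ f t)

theorem Comp.symm {f g : Loop X x₀} (h : Comp f g) : Comp g f := Or.symm h

theorem reflTransGen_of_homotopic {f g : Loop X x₀} (h : Homotopic f g) :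
    Relation.ReflTransGen Comp f g := by
  obtain ⟨p, H, hb, h0, hp⟩ := h
  let L : Zigzag.Seg p → Loop X x₀ := fun i =>
    ⟨⟨fun t => H (t, i), fun a b hab => H.monotone ⟨hab, le_refl _⟩⟩, hb i⟩
  have key : ∀ n : ℕ, ∀ hn : n ≤ p, Relation.ReflTransGen Comp f
      (L ⟨⟨n⟩, Int.natCast_nonneg n, Int.ofNat_le.2 hn⟩) := by
    intro n
    induction n with
    | zero =>
      intro _
      have : f = L ⟨⟨((0 : ℕ) : ℤ)⟩, Int.natCast_nonneg 0, by simp⟩ := ext_of fun t => (h0 t).symm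
      rw [← this]
    | succ n ih =>
      intro hn
      refine (ih (by omega)).tail ?_
      by_cases hev : Even (n : ℤ)
      · refine Or.inl fun t => H.monotone ⟨le_refl _, ?_⟩
        have := Zigzag.even_le_succ hev
        exact_mod_cast this
      · refine Or.inr fun t => H.monotone ⟨le_refl _, ?_⟩
        have := Zigzag.odd_succ_le hev
        exact_mod_cast this
  have := key p le_rfl
  have hg : g = L ⟨⟨p⟩, Int.natCast_nonneg p, le_rfl⟩ := ext_of fun t => (hp t).symm
  rw [hg]
  exact this

theorem homotopic_of_levels {f g : Loop X x₀} (p : ℕ) (K : ℕ → Loop X x₀) (h0 : K 0 = f)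
    (hp : K p = g)
    (hK : ∀ i, (Even i → ∀ t, K i t ≤ K (i + 1) t) ∧ (¬ Even i → ∀ t, K (i + 1) t ≤ K i t)) :
    Homotopic f g := by
  refine ⟨p, ⟨fun a => K a.2.1.val.toNat a.1, ?_⟩, fun i => (K i.1.val.toNat).bounded, ?_, ?_⟩
  · rintro ⟨t, ⟨⟨i⟩, hi⟩⟩ ⟨t', ⟨⟨j⟩, hj⟩⟩ ⟨h1, h2⟩
    simp only at h1 h2 hi hj ⊢
    refine le_trans ((K _).toHom.monotone h1) ?_
    rcases h2 with h2 | ⟨h2, h3⟩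
    · simp only [Zigzag.mk.injEq] at h2
      rw [h2]
    · simp only at h2 h3
      lift i to ℕ using hi.1
      lift j to ℕ using hj.1
      simp only [Int.toNat_natCast]
      have he : Even i := by exact_mod_cast h2
      rcases h3 with h3 | h3
      · have : j = i + 1 := by omega
        subst this
        exact (hK i).1 he t'
      · have : i = j + 1 := by omega
        subst this
        exact (hK j).2 (fun h => by rw [Nat.even_iff] at *; omega) t'
  · intro t
    change K (0 : ℤ).toNat t = f t
    rw [← h0]
    rfl
  · intro t
    change K (p : ℤ).toNat t = g t
    rw [← hp]
    rfl

theorem levels_of_reflTransGen {f g : Loop X x₀} (h : Relation.ReflTransGen Comp f g) :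
    ∃ (p : ℕ) (K : ℕ → Loop X x₀), K 0 = f ∧ K p = g ∧
    (∀ i, (Even i → ∀ t, K i t ≤ K (i + 1) t) ∧ (¬ Even i → ∀ t, K (i + 1) t ≤ K i t)) := by
  induction h with
  | refl => exact ⟨0, fun _ => f, rfl, rfl, fun i => ⟨fun _ _ => le_rfl, fun _ _ => le_rfl⟩⟩
  | @tail g h _ hgh ih =>
    obtain ⟨p, K, h0, hp, hK⟩ := ih
    have : ∃ q, p ≤ q ∧ ((Even q ∧ ∀ t, g t ≤ h t) ∨ (¬ Even q ∧ ∀ t, h t ≤ g t)) := by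
      rcases hgh with hgh | hgh
      · by_cases hp : Even p
        · exact ⟨p, le_rfl, Or.inl ⟨hp, hgh⟩⟩
        · exact ⟨p + 1, by omega, Or.inl ⟨by rw [Nat.even_iff] at *; omega, hgh⟩⟩
      · by_cases hp : Even p
        · exact ⟨p + 1, by omega, Or.inr ⟨by rw [Nat.even_iff] at *; omega, hgh⟩⟩
        · exact ⟨p, le_rfl, Or.inr ⟨hp, hgh⟩⟩
    obtain ⟨q, hpq, hq⟩ := this
    refine ⟨q + 1, fun i => if i ≤ q then K (min i p) else h, ?_, ?_, ?_⟩
    · simp [h0]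
    · simp
    · intro i
      by_cases h1 : i + 1 ≤ q
      · have h2 : i ≤ q := by omega
        simp only [h1, h2, if_true]
        by_cases h3 : i + 1 ≤ p
        · rw [min_eq_left h3, min_eq_left (by omega)]
          exact hK i
        · rw [min_eq_right (by omega), min_eq_right (by omega)]
          exact ⟨fun _ _ => le_rfl, fun _ _ => le_rfl⟩
      · by_cases h2 : i ≤ q
        · have h3 : i = q := by omega
          subst h3
          simp only [h1, le_refl, if_true, if_false, min_eq_right hpq, hp]
          rcases hq with ⟨h4, h5⟩ | ⟨h4, h5⟩
          · exact ⟨fun _ => h5, fun h => absurd h4 h⟩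
          · exact ⟨fun h => absurd h h4, fun _ => h5⟩
        · simp only [h1, h2, if_false]
          exact ⟨fun _ _ => le_rfl, fun _ _ => le_rfl⟩

theorem homotopic_iff {f g : Loop X x₀} : Homotopic f g ↔ Relation.ReflTransGen Comp f g := by
  refine ⟨reflTransGen_of_homotopic, fun h => ?_⟩
  obtain ⟨p, K, h0, hp, hK⟩ := levels_of_reflTransGen h
  exact homotopic_of_levels p K h0 hp hK

theorem Comp.homotopic {f g : Loop X x₀} (h : Comp f g) : Homotopic f g :=
  homotopic_iff.2 (Relation.ReflTransGen.single h)

theorem Homotopic.refl (f : Loop X x₀) : Homotopic f f := homotopic_iff.2 .refl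

theorem Homotopic.symm {f g : Loop X x₀} (h : Homotopic f g) : Homotopic g f := by
  have hs : Std.Symm (Comp (X := X) (x₀ := x₀)) := ⟨fun _ _ h => Comp.symm h⟩
  exact homotopic_iff.2 (Relation.ReflTransGen.stdSymm.symm _ _ (homotopic_iff.1 h))

theorem Homotopic.trans {f g h : Loop X x₀} (h₁ : Homotopic f g) (h₂ : Homotopic g h) :
    Homotopic f h :=
  homotopic_iff.2 ((homotopic_iff.1 h₁).trans (homotopic_iff.1 h₂))

/-- A map of loops that preserves comparability preserves homotopy. -/
theorem Homotopic.congr {F : Loop X x₀ → Loop X x₀}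
    (hF : ∀ f g, Comp f g → Homotopic (F f) (F g)) {f g : Loop X x₀} (h : Homotopic f g) :
    Homotopic (F f) (F g) := by
  have h' := homotopic_iff.1 h
  clear h
  induction h' with
  | refl => exact .refl _
  | tail _ h ih => exact ih.trans (hF _ _ h)

/-- The homotopy relation on loops. -/
instance setoid (X : Type*) [PartialOrder X] (x₀ : X) : Setoid (Loop X x₀) where
  r := Homotopic
  iseqv := ⟨Homotopic.refl, Homotopic.symm, Homotopic.trans⟩

/-- The constant loop. -/
def const (x₀ : X) : Loop X x₀ := ⟨⟨fun _ => x₀, fun _ _ _ => le_rfl⟩, 0, fun _ _ => rfl⟩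

/-- Inverting a loop: `t ↦ f (-t)`. -/
def reverse (f : Loop X x₀) : Loop X x₀ where
  toHom := f.toHom.comp
    { toFun := fun t => ⟨-t.val⟩
      monotone' := Zigzag.monotone_of_step fun x => by
        constructor
        · intro h
          exact Or.inr ⟨h.neg, Or.inr (by simp only; ring)⟩
        · intro h
          refine Or.inr ⟨?_, Or.inl (by simp only; ring)⟩
          simp only [Int.even_iff] at *
          omega }
  bounded := ⟨f.radius, fun t ht => f.radius_spec _ (by simpa using ht)⟩

/-- Data with which `f` (up to the point `c`) followed by `g` (translated by `s`) is a loop. -/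
structure Fits (c s : ℤ) (f g : Loop X x₀) : Prop where
  even : Even s
  left : ∀ t : Zigzag, c ≤ t.val → f t = x₀
  right : ∀ t : Zigzag, t.val ≤ c - s → g t = x₀

/-- The loop that is `f` on `t ≤ c` and `g (t - s)` on `t > c`. -/
def concatAt (c s : ℤ) (f g : Loop X x₀) (h : Fits c s f g) : Loop X x₀ where
  toHom :=
    { toFun := fun t => if t.val ≤ c then f t else g ⟨t.val - s⟩
      monotone' := Zigzag.monotone_of_step fun x => by
        have hs := h.even
        have e : x + 1 - s = x - s + 1 := by ring
        by_cases h1 : x + 1 ≤ c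
        · have h2 : x ≤ c := by omega
          simpa only [h1, h2, if_true] using Zigzag.comparable_succ f.toHom x
        · by_cases h2 : x ≤ c
          · have h3 : x = c := by omega
            subst h3
            have h4 := Zigzag.comparable_succ g.toHom (x - s)
            have h5 : Even (x - s) ↔ Even x := by
              simp only [Int.even_iff] at *
              omega
            rw [h.right ⟨x - s⟩ le_rfl, h5] at h4
            simp only [h1, le_refl, if_true, if_false, h.left ⟨x⟩ le_rfl, e]
            exact h4
          · have h4 := Zigzag.comparable_succ g.toHom (x - s)
            have h5 : Even (x - s) ↔ Even x := by
              simp only [Int.even_iff] at *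
              omega
            rw [h5] at h4
            simpa only [h1, h2, if_false, e] using h4 }
  bounded := by
    refine ⟨f.radius + g.radius + s.natAbs, fun t ht => ?_⟩
    have hs : |s| = (s.natAbs : ℤ) := Int.abs_eq_natAbs s
    change (if t.val ≤ c then f t else g ⟨t.val - s⟩) = x₀
    split_ifs with h1
    · exact f.radius_spec t (by omega)
    · refine g.radius_spec _ ?_
      simp only
      rw [le_abs] at *
      omega

theorem concatAt_apply {c s : ℤ} {f g : Loop X x₀} (h : Fits c s f g) (t : Zigzag) :
    concatAt c s f g h t = if t.val ≤ c then f t else g ⟨t.val - s⟩ := rfl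

theorem fits_radius (f g : Loop X x₀) {c s : ℤ} (hs : Even s) (hc : (f.radius : ℤ) ≤ c)
    (hcs : c + g.radius ≤ s) : Fits c s f g :=
  ⟨hs, fun _ ht => f.eq_of_ge (hc.trans ht), fun _ ht => g.eq_of_le (by linarith)⟩

/-- The amount by which the second factor of a product is translated: the least even integer
that is at least the sum of the two radii. (It has to be even, for `t ↦ g (t - s)` preserves the
order only then.) -/
noncomputable def offset (f g : Loop X x₀) : ℕ :=
  f.radius + g.radius + (f.radius + g.radius) % 2

theorem fits_offset (f g : Loop X x₀) : Fits f.radius (offset f g) f g := by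
  refine fits_radius f g ?_ le_rfl ?_
  · rw [Int.even_iff, offset]
    omega
  · rw [offset]
    omega

/-- The product of two loops: `(f · g) t` is `f t` for `t ≤ r` and `g (t - s)` for `t > r`, where
`r` is the radius of `f` and `s` is the offset. -/
noncomputable def mul (f g : Loop X x₀) : Loop X x₀ :=
  concatAt f.radius (offset f g) f g (fits_offset f g)

/-- The loop `f`, delayed by two units of time from the time `k` on. -/
def delay (k : ℤ) (f : Loop X x₀) : Loop X x₀ where
  toHom := f.toHom.comp
    { toFun := fun t => if t.val ≤ k then t else if t.val = k + 1 then ⟨k⟩ else ⟨t.val - 2⟩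
      monotone' := Zigzag.monotone_of_step fun x => by
        rw [Zigzag.le_def, Zigzag.le_def]
        simp only [Int.even_iff, Zigzag.ext_iff]
        split_ifs <;> simp only [true_or, and_true] <;> omega }
  bounded := by
    refine ⟨f.radius + 2, fun t ht => f.radius_spec _ ?_⟩
    simp only [OrderHom.coe_mk]
    rw [le_abs] at *
    split_ifs <;> (try dsimp only) <;> omega

theorem delay_apply (k : ℤ) (f : Loop X x₀) (t : Zigzag) : delay k f t =
    f (if t.val ≤ k then t else if t.val = k + 1 then ⟨k⟩ else ⟨t.val - 2⟩) := rfl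

theorem delay_comp (k : ℤ) (f : Loop X x₀) : Comp (delay (k + 1) f) (delay k f) := by
  have key : ∀ t : Zigzag, (Even k → delay k f t ≤ delay (k + 1) f t) ∧
      (¬ Even k → delay (k + 1) f t ≤ delay k f t) := by
    rintro ⟨t⟩
    simp only [delay_apply]
    constructor <;> intro hk
    all_goals
      refine f.toHom.monotone ?_
      rw [Zigzag.le_def]
      simp only [Int.even_iff, Zigzag.ext_iff] at *
      split_ifs <;> simp only [true_or, and_true] at * <;> omega
  by_cases hk : Even k
  · exact Or.inr fun t => (key t).1 hk
  · exact Or.inl fun t => (key t).2 hk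

theorem delay_homotopic_add (k : ℤ) (f : Loop X x₀) (n : ℕ) :
    Homotopic (delay (k + n) f) (delay k f) := by
  induction n with
  | zero => simpa using Homotopic.refl _
  | succ n ih =>
    refine Homotopic.trans (Comp.homotopic ?_) ih
    have := delay_comp (k + n) f
    push_cast
    rwa [← add_assoc]

theorem delay_homotopic (k : ℤ) (f : Loop X x₀) : Homotopic f (delay k f) := by
  have h := delay_homotopic_add k f (f.radius + k.natAbs)
  have e : delay (k + (f.radius + k.natAbs : ℕ)) f = f := by
    refine ext_of fun t => ?_
    rw [delay_apply]
    split_ifs with h1 h2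
    · rfl
    · rw [f.eq_of_ge (t := ⟨_⟩) (by dsimp only; omega), f.eq_of_ge (by omega)]
    · rw [f.eq_of_ge (t := ⟨_⟩) (by dsimp only; omega), f.eq_of_ge (by omega)]
  rwa [e] at h

theorem concatAt_homotopic_two {c s : ℤ} {f g : Loop X x₀} (h : Fits c s f g)
    (h' : Fits c (s + 2) f g) : Homotopic (concatAt c s f g h) (concatAt c (s + 2) f g h') := by
  have e : concatAt c (s + 2) f g h' = delay c (concatAt c s f g h) := by
    refine ext_of fun t => ?_
    rw [delay_apply, concatAt_apply, concatAt_apply]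
    have hfc := h.left ⟨c⟩ le_rfl
    by_cases h1 : t.val ≤ c
    · simp only [h1, if_true]
    · by_cases h2 : t.val = c + 1
      · simp only [h2, if_true, le_refl, add_le_iff_nonpos_right, if_neg (by norm_num : ¬ (1 : ℤ) ≤ 0)]
        rw [hfc]
        exact h.right _ (by simp only; omega)
      · by_cases h3 : t.val = c + 2
        · have h4 : ¬ (c + 2 ≤ c) := by omega
          have h5 : ¬ (c + 2 = c + 1) := by omega
          simp only [h3, h4, h5, if_false, add_sub_cancel_right, le_refl, if_true]
          rw [hfc]
          exact h.right _ (by simp only; omega)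
        · have h4 : ¬ (t.val - 2 ≤ c) := by omega
          simp only [h1, h2, h4, if_false]
          congr 2
          ring
  rw [e]
  exact delay_homotopic _ _

theorem Fits.mono {c s s' : ℤ} {f g : Loop X x₀} (h : Fits c s f g) (hs : s ≤ s') (he : Even s') :
    Fits c s' f g := ⟨he, h.left, fun t ht => h.right t (by linarith)⟩

theorem concatAt_homotopic_nat {c s : ℤ} {f g : Loop X x₀} (h : Fits c s f g) (n : ℕ)
    (h' : Fits c (s + 2 * n) f g) :
    Homotopic (concatAt c s f g h) (concatAt c (s + 2 * n) f g h') := by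
  induction n with
  | zero =>
    have e : concatAt c (s + 2 * (0 : ℕ)) f g h' = concatAt c s f g h :=
      ext_of fun t => by simp [concatAt_apply]
    rw [e]
    exact .refl _
  | succ n ih =>
    have h1 : Fits c (s + 2 * n) f g := h.mono (by omega) (h.even.add (even_two_mul _))
    have h2 : Fits c (s + 2 * n + 2) f g := h1.mono (by omega) (h1.even.add even_two)
    have e : concatAt c (s + 2 * (n + 1 : ℕ)) f g h' = concatAt c (s + 2 * n + 2) f g h2 :=
      ext_of fun t => by
        simp only [concatAt_apply]
        have : t.val - (s + 2 * (n + 1 : ℕ)) = t.val - (s + 2 * n + 2) := by push_cast; ring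
        rw [this]
    rw [e]
    exact (ih h1).trans (concatAt_homotopic_two h1 h2)

theorem concatAt_homotopic_of_le {c c' s s' : ℤ} {f g : Loop X x₀} (h : Fits c s f g)
    (h' : Fits c' s' f g) (hs : s ≤ s') :
    Homotopic (concatAt c s f g h) (concatAt c' s' f g h') := by
  have h1 : Fits c s' f g := h.mono hs h'.even
  obtain ⟨n, hn⟩ : ∃ n : ℕ, s' = s + 2 * n := by
    have a := h.even
    have b := h'.even
    rw [Int.even_iff] at a b
    exact ⟨((s' - s) / 2).toNat, by omega⟩
  subst hn
  refine (concatAt_homotopic_nat h n h1).trans ?_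
  have e : concatAt c (s + 2 * n) f g h1 = concatAt c' (s + 2 * n) f g h' := by
    refine ext_of fun t => ?_
    rw [concatAt_apply, concatAt_apply]
    split_ifs with h2 h3 h3
    · rfl
    · rw [h'.left t (by omega), h1.right _ (by simp only; omega)]
    · rw [h1.left t (by omega), h'.right _ (by simp only; omega)]
    · rfl
  rw [e]
  exact .refl _

theorem concatAt_homotopic {c c' s s' : ℤ} {f g : Loop X x₀} (h : Fits c s f g)
    (h' : Fits c' s' f g) : Homotopic (concatAt c s f g h) (concatAt c' s' f g h') := by
  rcases le_total s s' with hs | hs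
  · exact concatAt_homotopic_of_le h h' hs
  · exact (concatAt_homotopic_of_le h' h hs).symm

theorem mul_homotopic_concatAt {c s : ℤ} {f g : Loop X x₀} (h : Fits c s f g) :
    Homotopic (mul f g) (concatAt c s f g h) := concatAt_homotopic _ _

theorem mul_comp_left {f f' : Loop X x₀} (g : Loop X x₀) (h : Comp f f') :
    Homotopic (mul f g) (mul f' g) := by
  have h1 : Fits (f.radius + f'.radius) (2 * (f.radius + f'.radius + g.radius)) f g :=
    fits_radius _ _ (even_two_mul _) (by omega) (by omega)
  have h2 : Fits (f.radius + f'.radius) (2 * (f.radius + f'.radius + g.radius)) f' g :=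
    fits_radius _ _ (even_two_mul _) (by omega) (by omega)
  refine (mul_homotopic_concatAt h1).trans (.trans (Comp.homotopic ?_)
    (mul_homotopic_concatAt h2).symm)
  refine h.imp (fun h t => ?_) (fun h t => ?_)
  all_goals
    rw [concatAt_apply, concatAt_apply]
    split_ifs
    · exact h t
    · exact le_rfl

theorem mul_comp_right (f : Loop X x₀) {g g' : Loop X x₀} (h : Comp g g') :
    Homotopic (mul f g) (mul f g') := by
  have h1 : Fits f.radius (2 * (f.radius + g.radius + g'.radius)) f g :=
    fits_radius _ _ (even_two_mul _) (by omega) (by omega)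
  have h2 : Fits f.radius (2 * (f.radius + g.radius + g'.radius)) f g' :=
    fits_radius _ _ (even_two_mul _) (by omega) (by omega)
  refine (mul_homotopic_concatAt h1).trans (.trans (Comp.homotopic ?_)
    (mul_homotopic_concatAt h2).symm)
  refine h.imp (fun h t => ?_) (fun h t => ?_)
  all_goals
    rw [concatAt_apply, concatAt_apply]
    split_ifs
    · exact le_rfl
    · exact h _

theorem mul_congr {f f' g g' : Loop X x₀} (hf : Homotopic f f') (hg : Homotopic g g') :
    Homotopic (mul f g) (mul f' g') :=
  (hf.congr (F := fun f => mul f g) fun _ _ h => mul_comp_left g h).trans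
    (hg.congr (F := fun g => mul f' g) fun _ _ h => mul_comp_right f' h)

theorem reverse_congr {f g : Loop X x₀} (h : Homotopic f g) :
    Homotopic (reverse f) (reverse g) :=
  h.congr fun _ _ h => Comp.homotopic <| h.imp (fun h _ => h _) (fun h _ => h _)

theorem mul_assoc_homotopic (f g h : Loop X x₀) :
    Homotopic (mul (mul f g) h) (mul f (mul g h)) := by
  obtain ⟨a, ha⟩ : ∃ a : ℤ, a = f.radius := ⟨_, rfl⟩
  obtain ⟨b, hb⟩ : ∃ b : ℤ, b = g.radius := ⟨_, rfl⟩
  obtain ⟨d, hd⟩ : ∃ d : ℤ, d = h.radius := ⟨_, rfl⟩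
  have h1 : Fits a (2 * (a + b)) f g := fits_radius _ _ (even_two_mul _) (by omega) (by omega)
  have h2 : Fits b (2 * (b + d)) g h := fits_radius _ _ (even_two_mul _) (by omega) (by omega)
  have h3 : Fits (2 * (a + b) + b) (2 * (a + b) + 2 * (b + d)) (concatAt _ _ f g h1) h := by
    refine ⟨(even_two_mul _).add (even_two_mul _), fun t ht => ?_, fun t ht => h.eq_of_le (by omega)⟩
    rw [concatAt_apply]
    split_ifs
    · exact f.eq_of_ge (by omega)
    · exact g.eq_of_ge (by simp only; omega)
  have h4 : Fits a (2 * (a + b)) f (concatAt _ _ g h h2) := by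
    refine ⟨even_two_mul _, fun t ht => f.eq_of_ge (by omega), fun t ht => ?_⟩
    rw [concatAt_apply]
    rw [if_pos (by omega)]
    exact g.eq_of_le (by omega)
  have e : concatAt _ _ _ _ h3 = concatAt _ _ _ _ h4 := by
    refine ext_of fun t => ?_
    simp only [concatAt_apply]
    split_ifs
    · rfl
    · rfl
    · omega
    · omega
    · omega
    · congr 2
      ring
  have h5 : Homotopic (mul (mul f g) h) (concatAt _ _ _ _ h3) :=
    (mul_congr (mul_homotopic_concatAt h1) (.refl h)).trans (mul_homotopic_concatAt h3)
  have h6 : Homotopic (mul f (mul g h)) (concatAt _ _ _ _ h4) :=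
    (mul_congr (.refl f) (mul_homotopic_concatAt h2)).trans (mul_homotopic_concatAt h4)
  rw [e] at h5
  exact h5.trans h6.symm

theorem const_mul_homotopic (f : Loop X x₀) : Homotopic (mul (const x₀) f) f := by
  have h : Fits (-f.radius : ℤ) 0 (const x₀) f :=
    ⟨Even.zero, fun _ _ => rfl, fun t ht => f.eq_of_le (by omega)⟩
  have e : concatAt _ _ _ _ h = f := by
    refine ext_of fun t => ?_
    rw [concatAt_apply]
    split_ifs with h1
    · exact (f.eq_of_le h1).symm
    · simp
  have := mul_homotopic_concatAt h
  rwa [e] at this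

theorem mul_const_homotopic (f : Loop X x₀) : Homotopic (mul f (const x₀)) f := by
  have h : Fits (f.radius : ℤ) 0 f (const x₀) :=
    ⟨Even.zero, fun t ht => f.eq_of_ge (by omega), fun _ _ => rfl⟩
  have e : concatAt _ _ _ _ h = f := by
    refine ext_of fun t => ?_
    rw [concatAt_apply]
    split_ifs with h1
    · rfl
    · exact (f.eq_of_ge (by omega)).symm
  have := mul_homotopic_concatAt h
  rwa [e] at this

/-- The loop that follows `f` until the time `k ≤ c`, pauses, and returns the same way. -/
def tent (c k : ℤ) (f : Loop X x₀) : Loop X x₀ where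
  toHom := f.toHom.comp
    { toFun := fun t => ⟨min (min t.val (2 * c - t.val)) k⟩
      monotone' := Zigzag.monotone_of_step fun x => by
        rw [Zigzag.le_def, Zigzag.le_def]
        simp only [Int.even_iff, Zigzag.ext_iff]
        omega }
  bounded := by
    refine ⟨f.radius + 2 * c.natAbs, fun t ht => f.eq_of_le ?_⟩
    simp only [OrderHom.coe_mk]
    rw [le_abs] at *
    omega

theorem tent_comp (c k : ℤ) (f : Loop X x₀) : Comp (tent c (k + 1) f) (tent c k f) := by
  have key : ∀ t : Zigzag, (Even k → tent c k f t ≤ tent c (k + 1) f t) ∧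
      (¬ Even k → tent c (k + 1) f t ≤ tent c k f t) := by
    rintro ⟨t⟩
    constructor <;> intro hk
    all_goals
      refine f.toHom.monotone ?_
      rw [Zigzag.le_def]
      simp only [Int.even_iff, Zigzag.ext_iff, OrderHom.coe_mk] at *
      omega
  by_cases hk : Even k
  · exact Or.inr fun t => (key t).1 hk
  · exact Or.inl fun t => (key t).2 hk

theorem tent_homotopic_add (c k : ℤ) (f : Loop X x₀) (n : ℕ) :
    Homotopic (tent c (k + n) f) (tent c k f) := by
  induction n with
  | zero => simpa using Homotopic.refl _
  | succ n ih =>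
    refine Homotopic.trans (Comp.homotopic ?_) ih
    have := tent_comp c (k + n) f
    push_cast
    rwa [← add_assoc]

theorem mul_reverse_homotopic (f : Loop X x₀) : Homotopic (mul f (reverse f)) (const x₀) := by
  have h : Fits (f.radius : ℤ) (2 * f.radius) f (reverse f) := by
    refine ⟨even_two_mul _, fun t ht => f.eq_of_ge (by omega), fun t ht => ?_⟩
    exact f.eq_of_ge (t := ⟨-t.val⟩) (by simp only; omega)
  have e : concatAt _ _ _ _ h = tent f.radius (-f.radius + (2 * f.radius : ℕ)) f := by
    refine ext_of fun t => ?_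
    rw [concatAt_apply]
    split_ifs with h1
    · change f t = f ⟨_⟩
      congr 1
      ext
      simp only
      omega
    · change f ⟨-(t.val - 2 * f.radius)⟩ = f ⟨_⟩
      congr 1
      ext
      simp only
      omega
  have e' : tent f.radius (-f.radius) f = const x₀ := by
    refine ext_of fun t => f.eq_of_le ?_
    simp only [OrderHom.coe_mk]
    omega
  have h1 := mul_homotopic_concatAt h
  have h2 := tent_homotopic_add f.radius (-f.radius) f (2 * f.radius)
  rw [e] at h1
  rw [e'] at h2
  exact h1.trans h2

theorem reverse_reverse (f : Loop X x₀) : reverse (reverse f) = f := by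
  refine ext_of fun t => ?_
  change f ⟨- -t.val⟩ = f t
  simp

theorem reverse_mul_homotopic (f : Loop X x₀) : Homotopic (mul (reverse f) f) (const x₀) := by
  have := mul_reverse_homotopic (reverse f)
  rwa [reverse_reverse] at this

end Loop

/-- The first discrete homotopy group `π₁ᴰ(X, x₀)`: homotopy classes of loops. -/
def Pi1 (X : Type*) [PartialOrder X] (x₀ : X) : Type _ := Quotient (Loop.setoid X x₀)

namespace Pi1

/-- The homotopy class of a loop. -/
def mk (f : Loop X x₀) : Pi1 X x₀ := Quotient.mk (Loop.setoid X x₀) f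

noncomputable instance : Group (Pi1 X x₀) where
  mul := Quotient.map₂ Loop.mul fun _ _ h₁ _ _ h₂ => Loop.mul_congr h₁ h₂
  one := mk (Loop.const x₀)
  inv := Quotient.map Loop.reverse fun _ _ h => Loop.reverse_congr h
  mul_assoc := by
    rintro ⟨f⟩ ⟨g⟩ ⟨h⟩
    exact Quotient.sound (Loop.mul_assoc_homotopic f g h)
  one_mul := by
    rintro ⟨f⟩
    exact Quotient.sound (Loop.const_mul_homotopic f)
  mul_one := by
    rintro ⟨f⟩
    exact Quotient.sound (Loop.mul_const_homotopic f)
  inv_mul_cancel := by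
    rintro ⟨f⟩
    exact Quotient.sound (Loop.reverse_mul_homotopic f)

theorem mk_mul (f g : Loop X x₀) : mk f * mk g = mk (f.mul g) := rfl

end Pi1

/-! ### Discrete cubical homology -/

/-- An `n`-cube of `X`: an order-preserving map `{0 < 1}ⁿ → X`. -/
abbrev Cube (X : Type*) [PartialOrder X] (n : ℕ) : Type _ := (Fin n → Bool) →o X

/-- The `i`-th face of a cube, with the `i`-th coordinate set to `ε`. The front face `f_i⁻` has
`ε = false`, the back face `f_i⁺` has `ε = true`. -/
def face {n : ℕ} (i : Fin (n + 1)) (ε : Bool) (σ : Cube X (n + 1)) : Cube X n where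
  toFun a := σ (i.insertNth (α := fun _ => Bool) ε a)
  monotone' a b hab := σ.monotone <| by
    rw [Pi.le_def, Fin.forall_iff_succAbove i]
    exact ⟨by simp, fun k => by simpa using hab k⟩

theorem face_apply {n : ℕ} (i : Fin (n + 1)) (ε : Bool) (σ : Cube X (n + 1)) (a : Fin n → Bool) :
    face i ε σ a = σ (i.insertNth (α := fun _ => Bool) ε a) := rfl

/-- A cube is degenerate if its front and back faces in some direction agree. -/
def IsDegenerate : ∀ {n : ℕ}, Cube X n → Prop
  | 0, _ => False
  | _ + 1, σ => ∃ i, face i false σ = face i true σ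

/-- The free abelian group on all `n`-cubes. -/
abbrev LChain (X : Type*) [PartialOrder X] (n : ℕ) : Type _ := FreeAbelianGroup (Cube X n)

/-- The subgroup generated by the degenerate `n`-cubes. -/
def degenerateChains (X : Type*) [PartialOrder X] (n : ℕ) : AddSubgroup (LChain X n) :=
  AddSubgroup.closure {c | ∃ σ : Cube X n, IsDegenerate σ ∧ FreeAbelianGroup.of σ = c}

/-- The group of `n`-chains: all cubes modulo degenerate cubes. -/
abbrev Chain (X : Type*) [PartialOrder X] (n : ℕ) : Type _ := LChain X n ⧸ degenerateChains X n

/-- The boundary before passing to the quotient: for directions `i = 1, …, n + 1` the sum of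
`(-1) ^ i (f_i⁻ σ - f_i⁺ σ)`; here `i` is counted from `0`. -/
def boundaryL (X : Type*) [PartialOrder X] (n : ℕ) : LChain X (n + 1) →+ LChain X n :=
  FreeAbelianGroup.lift fun σ => ∑ i : Fin (n + 1), (-1 : ℤ) ^ ((i : ℕ) + 1) •
    (FreeAbelianGroup.of (face i false σ) - FreeAbelianGroup.of (face i true σ))

theorem isDegenerate_face {n : ℕ} {i j : Fin (n + 1)} (hij : i ≠ j) (ε : Bool)
    {σ : Cube X (n + 1)} (h : face i false σ = face i true σ) : IsDegenerate (face j ε σ) := by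
  cases n with
  | zero => exact absurd ((Fin.fin_one_eq_zero i).trans (Fin.fin_one_eq_zero j).symm) hij
  | succ n =>
    have hu : ∀ (x : Fin (n + 2) → Bool) (b : Bool), σ (Function.update x i b) = σ x := by
      have h1 : ∀ (x : Fin (n + 2) → Bool) (b : Bool),
          σ (Function.update x i b) = face i false σ (i.removeNth x) := by
        intro x b
        have h2 : Function.update x i b
            = i.insertNth (α := fun _ => Bool) b (i.removeNth x) := by simp
        rw [h2]
        cases b
        · rfl
        · rw [h]
          rfl
      intro x b
      have h2 := h1 x (x i)
      rw [Function.update_eq_self] at h2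
      rw [h1, h2]
    obtain ⟨k, rfl⟩ := Fin.exists_succAbove_eq hij
    refine ⟨k, OrderHom.ext _ _ (funext fun a => ?_)⟩
    rw [face_apply, face_apply, face_apply, face_apply]
    rw [← hu (j.insertNth (α := fun _ => Bool) ε (k.insertNth (α := fun _ => Bool) true a)) false]
    congr 1
    funext m
    rcases Fin.eq_self_or_eq_succAbove j m with rfl | ⟨m, rfl⟩
    · rw [Function.update_of_ne (Fin.succAbove_ne _ _).symm]
      simp
    · rcases Fin.eq_self_or_eq_succAbove k m with rfl | ⟨m, rfl⟩
      · simp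
      · rw [Function.update_of_ne]
        · simp
        · intro h
          exact Fin.succAbove_ne _ _ (Fin.succAbove_right_injective h)

theorem boundaryL_degenerate (X : Type*) [PartialOrder X] (n : ℕ) :
    degenerateChains X (n + 1) ≤ (degenerateChains X n).comap (boundaryL X n) := by
  rw [degenerateChains, AddSubgroup.closure_le]
  rintro _ ⟨σ, ⟨i, hi⟩, rfl⟩
  rw [SetLike.mem_coe, AddSubgroup.mem_comap, boundaryL, FreeAbelianGroup.lift_apply_of]
  refine AddSubgroup.sum_mem _ fun j _ => AddSubgroup.zsmul_mem _ ?_ _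
  by_cases hij : i = j
  · subst hij
    rw [hi, sub_self]
    exact AddSubgroup.zero_mem _
  · exact AddSubgroup.sub_mem _
      (AddSubgroup.subset_closure ⟨_, isDegenerate_face hij _ hi, rfl⟩)
      (AddSubgroup.subset_closure ⟨_, isDegenerate_face hij _ hi, rfl⟩)

/-- The boundary map of the cubical chain complex. -/
def boundary (X : Type*) [PartialOrder X] (n : ℕ) : Chain X (n + 1) →+ Chain X n :=
  QuotientAddGroup.map _ _ (boundaryL X n) (boundaryL_degenerate X n)

/-- The `n`-cycles: the kernel of the boundary map; every `0`-chain is a cycle. -/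
def cycles (X : Type*) [PartialOrder X] : ∀ n : ℕ, AddSubgroup (Chain X n)
  | 0 => ⊤
  | n + 1 => (boundary X n).ker

/-- The `n`-boundaries. -/
def boundaries (X : Type*) [PartialOrder X] (n : ℕ) : AddSubgroup (Chain X n) :=
  (boundary X n).range

/-- The `n`-th discrete cubical homology group: cycles modulo boundaries. -/
abbrev CubicalHomology (X : Type*) [PartialOrder X] (n : ℕ) : Type _ :=
  cycles X n ⧸ (boundaries X n).addSubgroupOf (cycles X n)

/-- The class of a cube in the group of chains. -/
def cubeChain {n : ℕ} (σ : Cube X n) : Chain X n := QuotientAddGroup.mk (FreeAbelianGroup.of σ)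

theorem cubeChain_eq_zero {n : ℕ} {σ : Cube X n} (h : IsDegenerate σ) : cubeChain σ = 0 :=
  (QuotientAddGroup.eq_zero_iff _).2 (AddSubgroup.subset_closure ⟨σ, h, rfl⟩)

theorem boundary_cubeChain {n : ℕ} (σ : Cube X (n + 1)) :
    boundary X n (cubeChain σ) = ∑ i : Fin (n + 1), (-1 : ℤ) ^ ((i : ℕ) + 1) •
      (cubeChain (face i false σ) - cubeChain (face i true σ)) := by
  change QuotientAddGroup.mk' (degenerateChains X n) (boundaryL X n (FreeAbelianGroup.of σ)) = _
  rw [boundaryL, FreeAbelianGroup.lift_apply_of, map_sum]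
  rfl

/-- The cubical identity: two faces in different directions commute. -/
theorem face_face {n : ℕ} (i : Fin (n + 2)) (j : Fin (n + 1)) (δ ε : Bool)
    (σ : Cube X (n + 2)) :
    face (j.predAbove i) δ (face (i.succAbove j) ε σ) = face j ε (face i δ σ) := by
  refine OrderHom.ext _ _ (funext fun a => ?_)
  simp only [face_apply]
  congr 1
  funext m
  rcases Fin.eq_self_or_eq_succAbove i m with rfl | ⟨m, rfl⟩
  · rw [Fin.insertNth_apply_same]
    have h := Fin.insertNth_apply_succAbove (α := fun _ => Bool) (m.succAbove j) ε
      ((j.predAbove m).insertNth (α := fun _ => Bool) δ a) (j.predAbove m)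
    rw [Fin.succAbove_succAbove_predAbove, Fin.insertNth_apply_same] at h
    exact h
  · rcases Fin.eq_self_or_eq_succAbove j m with rfl | ⟨m, rfl⟩
    · simp only [Fin.insertNth_apply_succAbove, Fin.insertNth_apply_same]
    · rw [Fin.insertNth_apply_succAbove, Fin.insertNth_apply_succAbove,
        ← Fin.succAbove_succAbove_succAbove_predAbove, Fin.insertNth_apply_succAbove,
        Fin.insertNth_apply_succAbove]

theorem boundary_boundary (n : ℕ) (c : Chain X (n + 2)) :
    boundary X n (boundary X (n + 1) c) = 0 := by
  have key : ∀ σ : Cube X (n + 2), boundary X n (boundary X (n + 1) (cubeChain σ)) = 0 := by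
    intro σ
    simp only [boundary_cubeChain, map_sum, map_zsmul, map_sub, ← smul_sub, Finset.smul_sum,
      smul_smul, ← Finset.sum_sub_distrib]
    rw [← Fintype.sum_prod_type']
    refine Finset.sum_involution (fun p _ => (p.1.succAbove p.2, p.2.predAbove p.1)) ?_ ?_ ?_ ?_
    · rintro ⟨i, j⟩ _
      simp only [face_face]
      have hs : (-1 : ℤ) ^ ((i.succAbove j : ℕ) + 1) * (-1) ^ ((j.predAbove i : ℕ) + 1) =
          -((-1) ^ ((i : ℕ) + 1) * (-1) ^ ((j : ℕ) + 1)) := by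
        have := Fin.neg_one_pow_succAbove_add_predAbove (R := ℤ) i j
        rw [pow_add, pow_add] at this
        rw [pow_succ, pow_succ, pow_succ, pow_succ]
        linear_combination this
      rw [hs, neg_smul, ← sub_eq_add_neg, ← smul_sub]
      convert smul_zero _
      abel
    · rintro ⟨i, j⟩ _ _ h
      exact Fin.succAbove_ne _ _ (Prod.ext_iff.1 h).1
    · intro _ _
      exact Finset.mem_univ _
    · rintro ⟨i, j⟩ _
      exact Prod.ext (Fin.succAbove_succAbove_predAbove i j)
        (Fin.predAbove_predAbove_succAbove i j)
  obtain ⟨c, rfl⟩ := QuotientAddGroup.mk_surjective c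
  induction c using FreeAbelianGroup.induction_on with
  | zero => exact map_zero _
  | of σ => exact key σ
  | neg σ h =>
    rw [QuotientAddGroup.mk_neg, map_neg, map_neg, h, neg_zero]
  | add a b ha hb =>
    rw [QuotientAddGroup.mk_add, map_add, map_add, ha, hb, add_zero]

theorem boundaries_le_cycles : ∀ n : ℕ, boundaries X n ≤ cycles X n
  | 0 => le_top
  | n + 1 => by
    rintro _ ⟨c, rfl⟩
    exact boundary_boundary n c

/-! ### The discrete Hurewicz map in dimension one -/

/-- The edge of the zigzag poset between `x` and `x + 1`, as a map from `{0 < 1}`. It runs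
from `x` to `x + 1` if `x` is even, and from `x + 1` to `x` if `x` is odd. -/
def edge (x : ℤ) : (Fin 1 → Bool) →o Zigzag where
  toFun y := if (y 0 = true ↔ Even x) then ⟨x + 1⟩ else ⟨x⟩
  monotone' a b hab := by
    have h := hab 0
    by_cases hx : Even x
    · cases ha : a 0 <;> cases hb : b 0 <;>
        simp only [ha, hb, hx, iff_self, iff_true, if_true, Bool.false_eq_true, if_false, le_refl]
      · exact Zigzag.even_le_succ hx
      · exact absurd (ha ▸ hb ▸ h) (by decide)
    · cases ha : a 0 <;> cases hb : b 0 <;>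
        simp only [ha, hb, hx, iff_false, not_true, if_true, Bool.false_eq_true,
          if_false, le_refl]
      · exact Zigzag.odd_succ_le hx
      · exact absurd (ha ▸ hb ▸ h) (by decide)

/-- The `1`-chain of `X` that a zigzag `f` traverses between the times `x` and `x + 1`: the
`1`-cube `f x ≤ f (x + 1)` if `x` is even, and minus the `1`-cube `f (x + 1) ≤ f x` if `x` is
odd. -/
def edgeChain (f : Zigzag →o X) (x : ℤ) : Chain X 1 :=
  (if Even x then (1 : ℤ) else -1) • cubeChain (f.comp (edge x))

/-- The `1`-chain of `X` that a zigzag `f` traverses between the times `0` and `p`. -/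
def pathChain (p : ℕ) (f : Zigzag →o X) : Chain X 1 :=
  ∑ x ∈ Finset.range p, edgeChain f x

/-- The chain of a loop `f` of radius `r`: translate `f` by `2r` and take the chain that it
traverses between the times `0` and `4r`. -/
noncomputable def loopChain (f : Loop X x₀) : Chain X 1 :=
  pathChain (4 * f.radius)
    (f.toHom.comp (Zigzag.translate (2 * f.radius) (even_two_mul _)))

theorem edgeChain_congr {f f' : Zigzag →o X} {x x' : ℤ} (he : Even x ↔ Even x')
    (h0 : f ⟨x⟩ = f' ⟨x'⟩) (h1 : f ⟨x + 1⟩ = f' ⟨x' + 1⟩) : edgeChain f x = edgeChain f' x' := by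
  have : f.comp (edge x) = f'.comp (edge x') := by
    refine OrderHom.ext _ _ (funext fun y => ?_)
    change f (if (y 0 = true ↔ Even x) then ⟨x + 1⟩ else ⟨x⟩) =
      f' (if (y 0 = true ↔ Even x') then ⟨x' + 1⟩ else ⟨x'⟩)
    simp only [he]
    split_ifs
    · exact h1
    · exact h0
  rw [edgeChain, edgeChain, this]
  simp only [he]

theorem edgeChain_eq_zero {f : Zigzag →o X} {x : ℤ} (h : f ⟨x⟩ = f ⟨x + 1⟩) :
    edgeChain f x = 0 := by
  rw [edgeChain, cubeChain_eq_zero, smul_zero]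
  refine ⟨0, OrderHom.ext _ _ (funext fun a => ?_)⟩
  have key : ∀ y, f.comp (edge x) y = f ⟨x⟩ := by
    intro y
    change f (if (y 0 = true ↔ Even x) then ⟨x + 1⟩ else ⟨x⟩) = _
    split_ifs
    · exact h.symm
    · rfl
  rw [face_apply, face_apply, key, key]

/-- A point as a `0`-chain. -/
def pointChain (a : X) : Chain X 0 := cubeChain ⟨fun _ => a, fun _ _ _ => le_rfl⟩

theorem boundary_edgeChain (f : Zigzag →o X) (x : ℤ) :
    boundary X 0 (edgeChain f x) = pointChain (f ⟨x + 1⟩) - pointChain (f ⟨x⟩) := by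
  have h : ∀ ε : Bool, cubeChain (face 0 ε (f.comp (edge x))) =
      pointChain (f (if (ε = true ↔ Even x) then ⟨x + 1⟩ else ⟨x⟩)) := by
    intro ε
    rw [pointChain]
    congr 1
  rw [edgeChain, map_zsmul, boundary_cubeChain, Fin.sum_univ_one, h, h]
  by_cases hx : Even x <;> simp [hx]

namespace Loop

theorem edgeChain_eq_zero_of (f : Loop X x₀) {x : ℤ}
    (h : x + 1 ≤ -(f.radius : ℤ) ∨ (f.radius : ℤ) ≤ x) : edgeChain f.toHom x = 0 := by
  refine edgeChain_eq_zero ?_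
  rcases h with h | h
  · rw [f.eq_of_le (by dsimp only; omega), f.eq_of_le (by dsimp only; omega)]
  · rw [f.eq_of_ge (by dsimp only; omega), f.eq_of_ge (by dsimp only; omega)]

/-- A function on the integers that vanishes outside an interval has finite support. -/
theorem hasFiniteSupport_of {A : Type*} [Zero A] {F : ℤ → A} (r : ℤ)
    (h : ∀ x, x < -r ∨ r < x → F x = 0) : Function.HasFiniteSupport F := by
  refine (Set.finite_Icc (-r) r).subset fun x hx => ?_
  by_contra hn
  refine hx (h x ?_)
  rw [Set.mem_Icc] at hn
  omega

theorem edgeChain_hasFiniteSupport (f : Loop X x₀) :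
    Function.HasFiniteSupport fun x => edgeChain f.toHom x :=
  hasFiniteSupport_of f.radius fun _ hx => f.edgeChain_eq_zero_of (by omega)

theorem loopChain_eq_finsum (f : Loop X x₀) : loopChain f = ∑ᶠ x : ℤ, edgeChain f.toHom x := by
  have h1 : loopChain f = ∑ n ∈ Finset.range (4 * f.radius),
      edgeChain f.toHom ((n : ℤ) - 2 * f.radius) := by
    rw [loopChain, pathChain]
    refine Finset.sum_congr rfl fun n _ => ?_
    refine edgeChain_congr ?_ rfl ?_
    · simp only [Int.even_iff]
      omega
    · change f.toHom ⟨_⟩ = f.toHom ⟨_⟩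
      congr 2
      dsimp only
      ring
  rw [h1]
  rw [finsum_eq_sum_of_support_subset (fun x : ℤ => edgeChain f.toHom x)
    (s := (Finset.range (4 * f.radius)).image fun n : ℕ => (n : ℤ) - 2 * f.radius),
    Finset.sum_image]
  · intro a _ b _ h
    simp only at h
    omega
  · intro x hx
    have h2 : ¬ (x + 1 ≤ -(f.radius : ℤ) ∨ (f.radius : ℤ) ≤ x) := fun h =>
      hx (f.edgeChain_eq_zero_of h)
    simp only [Finset.coe_image, Finset.coe_range, Set.mem_image, Set.mem_Iio]
    exact ⟨(x + 2 * f.radius).toNat, by omega, by omega⟩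

theorem finsum_shift {A : Type*} [AddCommGroup A] (F : ℤ → A) (s : ℤ) :
    ∑ᶠ x : ℤ, F (x + s) = ∑ᶠ x : ℤ, F x :=
  finsum_comp_equiv (f := F) (Equiv.addRight s)

theorem loopChain_mem_cycles (f : Loop X x₀) : loopChain f ∈ cycles X 1 := by
  change boundary X 0 (loopChain f) = 0
  have hw : Function.HasFiniteSupport fun x : ℤ => pointChain (f ⟨x⟩) - pointChain x₀ := by
    refine hasFiniteSupport_of f.radius fun x hx => sub_eq_zero.2 (congrArg _ ?_)
    rcases hx with hx | hx
    · exact f.eq_of_le (by dsimp only; omega)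
    · exact f.eq_of_ge (by dsimp only; omega)
  have hw' : Function.HasFiniteSupport
      fun x : ℤ => pointChain (f ⟨x + 1⟩) - pointChain x₀ := by
    refine hasFiniteSupport_of (f.radius + 1) fun x hx => sub_eq_zero.2 (congrArg _ ?_)
    rcases hx with hx | hx
    · exact f.eq_of_le (by dsimp only; omega)
    · exact f.eq_of_ge (by dsimp only; omega)
  rw [loopChain_eq_finsum, AddMonoidHom.map_finsum _ f.edgeChain_hasFiniteSupport]
  have h1 : ∀ x : ℤ, boundary X 0 (edgeChain f.toHom x) =
      (pointChain (f ⟨x + 1⟩) - pointChain x₀) - (pointChain (f ⟨x⟩) - pointChain x₀) := by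
    intro x
    rw [boundary_edgeChain]
    abel
  simp_rw [h1]
  rw [finsum_sub_distrib hw' hw,
    finsum_shift (fun x : ℤ => pointChain (f ⟨x⟩) - pointChain x₀) 1, sub_self]

/-- The square between the edges of two comparable zigzags. -/
def square (f g : Zigzag →o X) (h : ∀ t, f t ≤ g t) (x : ℤ) : Cube X 2 where
  toFun y := if y 0 = true then g (edge x fun _ => y 1) else f (edge x fun _ => y 1)
  monotone' a b hab := by
    have h0 := hab 0
    have h1 : edge x (fun _ => a 1) ≤ edge x (fun _ => b 1) := (edge x).monotone fun _ => hab 1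
    cases ha : a 0 <;> cases hb : b 0 <;>
      simp only [ha, hb, if_true, Bool.false_eq_true, if_false]
    · exact f.monotone h1
    · exact (f.monotone h1).trans (h _)
    · exact absurd (ha ▸ hb ▸ h0) (by decide)
    · exact g.monotone h1

/-- The `1`-cube between the values at `t` of two comparable zigzags. -/
def vertical (f g : Zigzag →o X) (h : ∀ t, f t ≤ g t) (t : Zigzag) : Cube X 1 where
  toFun y := if y 0 = true then g t else f t
  monotone' a b hab := by
    have h0 := hab 0
    cases ha : a 0 <;> cases hb : b 0 <;>
      simp only [ha, hb, if_true, Bool.false_eq_true, if_false, le_refl]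
    · exact h _
    · exact absurd (ha ▸ hb ▸ h0) (by decide)

theorem boundary_square (f g : Zigzag →o X) (h : ∀ t, f t ≤ g t) (x : ℤ) :
    boundary X 1 ((if Even x then (1 : ℤ) else -1) • cubeChain (square f g h x)) =
      edgeChain g x - edgeChain f x +
        (cubeChain (vertical f g h ⟨x⟩) - cubeChain (vertical f g h ⟨x + 1⟩)) := by
  have e1 : face 0 false (square f g h x) = f.comp (edge x) := by
    refine OrderHom.ext _ _ (funext fun a => ?_)
    have : (fun _ : Fin 1 => a 0) = a := funext fun i => by rw [Fin.fin_one_eq_zero i]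
    change f (edge x fun _ => a 0) = f (edge x a)
    rw [this]
  have e2 : face 0 true (square f g h x) = g.comp (edge x) := by
    refine OrderHom.ext _ _ (funext fun a => ?_)
    have : (fun _ : Fin 1 => a 0) = a := funext fun i => by rw [Fin.fin_one_eq_zero i]
    change g (edge x fun _ => a 0) = g (edge x a)
    rw [this]
  have e3 : ∀ ε, face 1 ε (square f g h x) =
      vertical f g h (if (ε = true ↔ Even x) then ⟨x + 1⟩ else ⟨x⟩) := fun ε =>
    OrderHom.ext _ _ (funext fun a => rfl)
  rw [map_zsmul, boundary_cubeChain, Fin.sum_univ_two, e1, e2, e3, e3, edgeChain, edgeChain]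
  by_cases hx : Even x
  · simp [hx]
  · simp [hx]
    abel

theorem loopChain_sub_mem {f g : Loop X x₀} (h : ∀ t, f t ≤ g t) :
    loopChain g - loopChain f ∈ boundaries X 1 := by
  let V : ℤ → Chain X 1 := fun x => cubeChain (vertical f.toHom g.toHom h ⟨x⟩)
  have hV0 : ∀ x : ℤ, f ⟨x⟩ = g ⟨x⟩ → V x = 0 := by
    intro x hx
    refine cubeChain_eq_zero ⟨0, OrderHom.ext _ _ (funext fun a => ?_)⟩
    exact hx
  have hb : ∀ x : ℤ, x < -(f.radius + g.radius : ℤ) ∨ (f.radius + g.radius : ℤ) < x →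
      f ⟨x⟩ = g ⟨x⟩ := by
    rintro x (hx | hx)
    · rw [f.eq_of_le (by dsimp only; omega), g.eq_of_le (by dsimp only; omega)]
    · rw [f.eq_of_ge (by dsimp only; omega), g.eq_of_ge (by dsimp only; omega)]
  have hV : Function.HasFiniteSupport V :=
    hasFiniteSupport_of (f.radius + g.radius) fun x hx => hV0 x (hb x hx)
  have hV' : Function.HasFiniteSupport fun x => V (x + 1) :=
    hasFiniteSupport_of (f.radius + g.radius + 1) fun x hx => hV0 _ (hb _ (by omega))
  have key : loopChain g - loopChain f = ∑ᶠ x : ℤ, boundary X 1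
      ((if Even x then (1 : ℤ) else -1) • cubeChain (square f.toHom g.toHom h x)) := by
    simp_rw [boundary_square]
    rw [finsum_add_distrib (g.edgeChain_hasFiniteSupport.fun_sub f.edgeChain_hasFiniteSupport)
      (hV.fun_sub hV'), finsum_sub_distrib g.edgeChain_hasFiniteSupport f.edgeChain_hasFiniteSupport,
      finsum_sub_distrib hV hV', finsum_shift V 1, sub_self, add_zero, loopChain_eq_finsum,
      loopChain_eq_finsum]
  rw [key]
  exact finsum_induction (· ∈ boundaries X 1) (AddSubgroup.zero_mem _)
    (fun _ _ => AddSubgroup.add_mem _) fun x => ⟨_, rfl⟩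

theorem loopChain_sub_mem_of_homotopic {f g : Loop X x₀} (h : Homotopic f g) :
    loopChain g - loopChain f ∈ boundaries X 1 := by
  have h' := homotopic_iff.1 h
  clear h
  induction h' with
  | refl =>
    rw [sub_self]
    exact AddSubgroup.zero_mem _
  | @tail g k _ h ih =>
    have : loopChain k - loopChain g ∈ boundaries X 1 := by
      rcases h with h | h
      · exact loopChain_sub_mem h
      · rw [← neg_sub]
        exact AddSubgroup.neg_mem _ (loopChain_sub_mem h)
    rw [← sub_add_sub_cancel _ (loopChain g)]
    exact AddSubgroup.add_mem _ this ih

theorem edgeChain_concatAt {c s : ℤ} {f g : Loop X x₀} (h : Fits c s f g) (x : ℤ) :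
    edgeChain (concatAt c s f g h).toHom x =
      edgeChain f.toHom x + edgeChain g.toHom (x - s) := by
  have hs := h.even
  by_cases hx : x + 1 ≤ c
  · have h1 : edgeChain g.toHom (x - s) = 0 := edgeChain_eq_zero <| by
      rw [h.right _ (by dsimp only; omega), h.right _ (by dsimp only; omega)]
    rw [h1, add_zero]
    refine edgeChain_congr Iff.rfl ?_ ?_
    · rw [concatAt_apply, if_pos (by dsimp only; omega)]
    · rw [concatAt_apply, if_pos (by dsimp only; omega)]
  · have h1 : edgeChain f.toHom x = 0 := edgeChain_eq_zero <| by
      rw [h.left _ (by dsimp only; omega), h.left _ (by dsimp only; omega)]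
    rw [h1, zero_add]
    refine edgeChain_congr ?_ ?_ ?_
    · simp only [Int.even_iff] at *
      omega
    · rw [concatAt_apply]
      split_ifs with h2
      · dsimp only at h2
        rw [h.left _ (by dsimp only; omega), h.right _ (by dsimp only; omega)]
      · rfl
    · rw [concatAt_apply, if_neg (by dsimp only; omega)]
      congr 2
      dsimp only
      ring

theorem loopChain_mul (f g : Loop X x₀) : loopChain (mul f g) = loopChain f + loopChain g := by
  rw [loopChain_eq_finsum, loopChain_eq_finsum, loopChain_eq_finsum, mul]
  simp_rw [edgeChain_concatAt]
  have hg : Function.HasFiniteSupport fun x : ℤ => edgeChain g.toHom (x - offset f g) :=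
    hasFiniteSupport_of (g.radius + offset f g) fun x hx => g.edgeChain_eq_zero_of (by omega)
  rw [finsum_add_distrib f.edgeChain_hasFiniteSupport hg]
  congr 1
  simpa only [sub_eq_add_neg] using finsum_shift (fun x => edgeChain g.toHom x) (-(offset f g : ℤ))

end Loop

/-- The discrete Hurewicz map in dimension one, `[f] ↦ [loopChain f]`, as a homomorphism to the
first discrete cubical homology group (written multiplicatively). -/
noncomputable def hurewicz (X : Type*) [PartialOrder X] (x₀ : X) :
    Pi1 X x₀ →* Multiplicative (CubicalHomology X 1) :=
  MonoidHom.mk'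
    (Quotient.lift (s := Loop.setoid X x₀)
      (fun f => Multiplicative.ofAdd
        (QuotientAddGroup.mk (⟨loopChain f, f.loopChain_mem_cycles⟩ : cycles X 1)))
      (fun f g h => congrArg Multiplicative.ofAdd <| QuotientAddGroup.eq.2 <| by
        rw [AddSubgroup.mem_addSubgroupOf, AddSubgroup.coe_add, AddSubgroup.coe_neg, neg_add_eq_sub]
        exact Loop.loopChain_sub_mem_of_homotopic h))
    (by
      rintro ⟨f⟩ ⟨g⟩
      refine congrArg Multiplicative.ofAdd (congrArg QuotientAddGroup.mk ?_)
      exact Subtype.ext (Loop.loopChain_mul f g))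

theorem hurewicz_mk (f : Loop X x₀) : hurewicz X x₀ (Pi1.mk f) = Multiplicative.ofAdd
    (QuotientAddGroup.mk (⟨loopChain f, f.loopChain_mem_cycles⟩ : cycles X 1)) := rfl

end PosetHurewicz

/-! An inverse of the Hurewicz map is written down on chains. For every element `a` that
comparabilities link to `x₀`, choose a chain of comparable elements from `x₀` to `a`, the empty one
if `a = x₀`. A `1`-cube `a ≤ b` then closes up to the loop that goes to `a` along its chain, steps
to `b` and returns along the chain of `b`; cubes out of reach of `x₀` get the class `1`. Reading
these classes in the abelianization gives the homomorphism `closeUp` on `1`-chains. It kills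
boundaries, because both ways around a square of `X` are homotopic to its diagonal
(`closeUp_boundary`), and it takes the chain of a loop back to the class of the loop, because the
chosen chains cancel between successive edges (`closeUp_loopChain_ofList`). Hence a loop whose chain
bounds is trivial in the abelianization. This settles the kernel, with no connectedness needed.

For surjectivity, let `P` send each point to the chosen path leading to it. The chain of the loop
that closes up `a ≤ b` is the cube plus `P a - P b`, that is, the cube minus `P` of its boundary. By
linearity, the class of every cycle is a product of classes of such loops (`exists_hurewicz_eq`).

To compute with loops, they are replaced by finite lists. Every loop is homotopic to one that runs
through a closed chain of comparable elements (`exists_homotopic_ofList`), and a product of such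
loops is the concatenation of the lists with `x₀` in between (`Pi1.ofList_mul`). Two moves preserve
the homotopy class: replacing an entry by a comparable one (`Pi1.ofList_replace`) and dropping a
repetition (`Pi1.ofList_stutter`). All relations needed in the group follow from these, notably
`Pi1.ofList_backtrack`, `Pi1.ofList_shortcut` and `Pi1.ofList_split`. -/

namespace PosetHurewicz

variable {X : Type*} [PartialOrder X] {x₀ : X}

/-! ### Loops from sequences of comparable elements -/

/-- Comparability of two elements. -/
def Adj (a b : X) : Prop := a ≤ b ∨ b ≤ a

theorem Adj.refl (a : X) : Adj a a := Or.inl le_rfl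

theorem Adj.symm {a b : X} (h : Adj a b) : Adj b a := Or.symm h

open Classical in
/-- The greater of two comparable elements. -/
noncomputable def upper (a b : X) : X := if a ≤ b then b else a

theorem Adj.le_upper_left {a b : X} (_ : Adj a b) : a ≤ upper a b := by
  unfold upper
  split_ifs with h
  · exact h
  · exact le_rfl

theorem Adj.le_upper_right {a b : X} (hab : Adj a b) : b ≤ upper a b := by
  unfold upper
  split_ifs with h
  · exact le_rfl
  · exact hab.resolve_left h

theorem upper_le {a b c : X} (ha : a ≤ c) (hb : b ≤ c) : upper a b ≤ c := by
  unfold upper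
  split_ifs
  · exact hb
  · exact ha

theorem upper_self (a : X) : upper a a = a := by simp [upper]

theorem upper_of_le {a b : X} (h : a ≤ b) : upper a b = b := if_pos h

theorem upper_of_ge {a b : X} (h : b ≤ a) : upper a b = a := by
  unfold upper
  split_ifs with h1
  · exact le_antisymm h h1
  · rfl

/-- The sequence `u`, slowed down by a factor of two, with the greater of two successive values
inserted between them. -/
noncomputable def zigzagFun (u : ℤ → X) (t : Zigzag) : X :=
  if Even t.val then u (t.val / 2) else upper (u (t.val / 2)) (u (t.val / 2 + 1))

theorem zigzagFun_even (u : ℤ → X) (i : ℤ) : zigzagFun u ⟨2 * i⟩ = u i := by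
  simp [zigzagFun]

theorem zigzagFun_odd (u : ℤ → X) (i : ℤ) :
    zigzagFun u ⟨2 * i + 1⟩ = upper (u i) (u (i + 1)) := by
  have h : ¬ Even (2 * i + 1) := by simp
  have h' : (2 * i + 1) / 2 = i := by omega
  simp only [zigzagFun, h, if_false, h']

theorem Zigzag.cases_parity {p : Zigzag → Prop} (h0 : ∀ i, p ⟨2 * i⟩) (h1 : ∀ i, p ⟨2 * i + 1⟩)
    (t : Zigzag) : p t := by
  obtain ⟨t⟩ := t
  rcases Int.even_or_odd' t with ⟨i, rfl | rfl⟩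
  · exact h0 i
  · exact h1 i

/-- Odd integers are the maximal points of the zigzag order, which is why the greater of two
neighbours is the value to insert between them. -/
theorem monotone_zigzagFun {u : ℤ → X} (h : ∀ i, Adj (u i) (u (i + 1))) :
    Monotone (zigzagFun u) := by
  refine Zigzag.monotone_of_step fun x => ?_
  rcases Int.even_or_odd' x with ⟨i, rfl | rfl⟩
  · refine ⟨fun _ => ?_, fun h => absurd (even_two_mul i) h⟩
    rw [zigzagFun_even, zigzagFun_odd]
    exact (h i).le_upper_left
  · refine ⟨fun h => absurd h (Int.not_even_two_mul_add_one i), fun _ => ?_⟩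
    have e : 2 * i + 1 + 1 = 2 * (i + 1) := by ring
    rw [e, zigzagFun_even, zigzagFun_odd]
    exact (h i).le_upper_right

/-- On comparable pairs `upper` is the join. Only the joins of `v` have to be upper bounds here, so
comparability of neighbours is required of `v` alone. -/
theorem zigzagFun_le {u v : ℤ → X} (hu : ∀ i, u i ≤ v i)
    (hv : ∀ i, Adj (v i) (v (i + 1))) (t : Zigzag) : zigzagFun u t ≤ zigzagFun v t := by
  refine Zigzag.cases_parity (p := fun t => zigzagFun u t ≤ zigzagFun v t) (fun i => ?_)
    (fun i => ?_) t
  · rw [zigzagFun_even, zigzagFun_even]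
    exact hu i
  · rw [zigzagFun_odd, zigzagFun_odd]
    exact upper_le ((hu _).trans (hv i).le_upper_left) ((hu _).trans (hv i).le_upper_right)

/-! ### Finite lists as sequences on the integers, and closed chains. -/

section
variable {X : Type*} {x₀ : X}

/-- The sequence with the entries of the list `l` at the times `0, 1, …`, and `x₀` elsewhere. -/
def listSeq (x₀ : X) (l : List X) (i : ℤ) : X := if i < 0 then x₀ else l.getD i.toNat x₀

theorem listSeq_of_neg (l : List X) {i : ℤ} (h : i < 0) : listSeq x₀ l i = x₀ := if_pos h

theorem listSeq_of_ge (l : List X) {i : ℤ} (h : (l.length : ℤ) ≤ i) : listSeq x₀ l i = x₀ := by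
  unfold listSeq
  split_ifs
  · rfl
  · rw [List.getD_eq_default]
    omega

theorem listSeq_nil (i : ℤ) : listSeq x₀ [] i = x₀ := by
  unfold listSeq
  split_ifs <;> simp

theorem listSeq_append (l m : List X) (i : ℤ) : listSeq x₀ (l ++ m) i =
    if i < l.length then listSeq x₀ l i else listSeq x₀ m (i - l.length) := by
  unfold listSeq
  split_ifs with h1 h2 h3 h4 h5
  · rfl
  · rfl
  · omega
  · rw [List.getD_append _ _ _ _ (by omega)]
  · omega
  · rw [List.getD_append_right _ _ _ _ (by omega)]
    congr 1
    omega

theorem listSeq_cons (a : X) (l : List X) (i : ℤ) : listSeq x₀ (a :: l) i =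
    if i = 0 then a else listSeq x₀ l (i - 1) := by
  unfold listSeq
  split_ifs with h1 h2 h3 h4 h5
  · omega
  · rfl
  · omega
  · simp [h4]
  · omega
  · have : i.toNat = (i - 1).toNat + 1 := by omega
    rw [this, List.getD_cons_succ]

theorem listSeq_append_cons (l m : List X) (a : X) (i : ℤ) : listSeq x₀ (l ++ a :: m) i =
    if i < l.length then listSeq x₀ l i else if i = l.length then a
      else listSeq x₀ m (i - l.length - 1) := by
  rw [listSeq_append, listSeq_cons]
  simp only [sub_eq_zero]

end

/-- Successive members of the closed sequence `x₀, l, x₀` are comparable. -/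
def IsClosedChain (x₀ : X) (l : List X) : Prop := List.IsChain Adj (x₀ :: (l ++ [x₀]))

theorem IsClosedChain.adj_listSeq {l : List X} (h : IsClosedChain x₀ l) (i : ℤ) :
    Adj (listSeq x₀ l i) (listSeq x₀ l (i + 1)) := by
  have h' := List.isChain_iff_getElem.1 h
  by_cases h1 : i < -1
  · rw [listSeq_of_neg _ (by omega), listSeq_of_neg _ (by omega)]
    exact Adj.refl _
  by_cases h2 : (l.length : ℤ) ≤ i
  · rw [listSeq_of_ge _ (by omega), listSeq_of_ge _ (by omega)]
    exact Adj.refl _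
  -- The closed sequence starts with an extra `x₀`, so its position `n` corresponds to the index `n
  -- - 1`.
  have key : ∀ n : ℕ, ∀ hn : n < (x₀ :: (l ++ [x₀])).length,
      (x₀ :: (l ++ [x₀]))[n] = listSeq x₀ l (n - 1) := by
    intro n hn
    rcases n with _ | n
    · rw [listSeq_of_neg _ (by omega)]
      rfl
    · have hn' : n < l.length + 1 := by simpa using hn
      have e : ((n + 1 : ℕ) : ℤ) - 1 = n := by omega
      rw [List.getElem_cons_succ, e, listSeq, if_neg (by omega), Int.toNat_natCast]
      by_cases hl : n < l.length
      · rw [List.getElem_append_left hl, List.getD_eq_getElem _ _ hl]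
      · rw [List.getElem_append_right (by omega), List.getD_eq_default _ _ (by omega)]
        simp
  have h3 := h' (i + 1).toNat (by simp; omega)
  rw [key, key] at h3
  convert h3 using 2 <;> omega

/-! ### Loops that run through closed chains. -/

namespace Loop

/-- The loop that runs through a closed chain. -/
noncomputable def ofList (l : List X) (h : IsClosedChain x₀ l) : Loop X x₀ where
  toHom := ⟨zigzagFun (listSeq x₀ l), monotone_zigzagFun h.adj_listSeq⟩
  bounded := by
    -- Entry `i` is reached at time `2 * i`, but the loop may leave `x₀` at time `-1`, where the
    -- join of `x₀` with the first entry sits.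
    refine ⟨2 * l.length + 2, Zigzag.cases_parity (fun i hi => ?_) (fun i hi => ?_)⟩
    · simp only [OrderHom.coe_mk, zigzagFun_even]
      rw [le_abs] at hi
      rcases hi with hi | hi <;> push_cast at hi
      · exact listSeq_of_ge _ (by omega)
      · exact listSeq_of_neg _ (by omega)
    · simp only [OrderHom.coe_mk, zigzagFun_odd]
      rw [le_abs] at hi
      rcases hi with hi | hi <;> push_cast at hi
      · rw [listSeq_of_ge _ (by omega), listSeq_of_ge _ (by omega), upper_self]
      · rw [listSeq_of_neg _ (by omega), listSeq_of_neg _ (by omega), upper_self]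

theorem ofList_even {l : List X} (h : IsClosedChain x₀ l) (i : ℤ) :
    ofList l h ⟨2 * i⟩ = listSeq x₀ l i := zigzagFun_even _ _

theorem ofList_odd {l : List X} (h : IsClosedChain x₀ l) (i : ℤ) :
    ofList l h ⟨2 * i + 1⟩ = upper (listSeq x₀ l i) (listSeq x₀ l (i + 1)) := zigzagFun_odd _ _

theorem ofList_of_nonpos {l : List X} (h : IsClosedChain x₀ l) {t : Zigzag} (ht : t.val ≤ -2) :
    ofList l h t = x₀ := by
  revert ht
  refine Zigzag.cases_parity (p := fun t => t.val ≤ -2 → ofList l h t = x₀) (fun i hi => ?_)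
    (fun i hi => ?_) t <;> dsimp only at hi
  · rw [ofList_even, listSeq_of_neg _ (by omega)]
  · rw [ofList_odd, listSeq_of_neg _ (by omega), listSeq_of_neg _ (by omega), upper_self]

theorem ofList_of_ge {l : List X} (h : IsClosedChain x₀ l) {t : Zigzag}
    (ht : 2 * (l.length : ℤ) ≤ t.val) : ofList l h t = x₀ := by
  revert ht
  refine Zigzag.cases_parity (p := fun t => 2 * (l.length : ℤ) ≤ t.val → ofList l h t = x₀)
    (fun i hi => ?_) (fun i hi => ?_) t <;> dsimp only at hi
  · rw [ofList_even, listSeq_of_ge _ (by omega)]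
  · rw [ofList_odd, listSeq_of_ge _ (by omega), listSeq_of_ge _ (by omega), upper_self]

theorem ofList_mul {l m : List X} (hl : IsClosedChain x₀ l) (hm : IsClosedChain x₀ m)
    (h : IsClosedChain x₀ (l ++ x₀ :: m)) :
    Homotopic (mul (ofList l hl) (ofList m hm)) (ofList (l ++ x₀ :: m) h) := by
  -- The first loop is back at `x₀` from `2 * l.length` on, and the second rests up to `-2`. The
  -- extra `2` in the offset is the time slot of the `x₀` between the lists.
  have hf : Fits (2 * l.length) (2 * l.length + 2) (ofList l hl) (ofList m hm) :=
    ⟨(even_two_mul _).add even_two, fun t ht => ofList_of_ge _ ht,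
      fun t ht => ofList_of_nonpos _ (by omega)⟩
  convert mul_homotopic_concatAt hf using 1
  have hs : ∀ i : ℤ, i ≤ l.length → listSeq x₀ (l ++ x₀ :: m) i = listSeq x₀ l i := by
    intro i hi
    rw [listSeq_append_cons]
    split_ifs with h1 h2
    · rfl
    · rw [listSeq_of_ge _ (by omega)]
    · omega
  have hs' : ∀ i : ℤ, l.length ≤ i →
      listSeq x₀ (l ++ x₀ :: m) i = listSeq x₀ m (i - l.length - 1) := by
    intro i hi
    rw [listSeq_append_cons]
    split_ifs with h1 h2
    · omega
    · rw [listSeq_of_neg _ (by omega)]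
    · rfl
  refine ext_of (Zigzag.cases_parity (fun i => ?_) (fun i => ?_))
  · rw [ofList_even, concatAt_apply]
    split_ifs with h1 <;> dsimp only at h1 ⊢
    · rw [ofList_even, hs _ (by omega)]
    · have e : 2 * i - (2 * (l.length : ℤ) + 2) = 2 * (i - l.length - 1) := by ring
      rw [e, ofList_even, hs' _ (by omega)]
  · rw [ofList_odd, concatAt_apply]
    split_ifs with h1 <;> dsimp only at h1 ⊢
    · rw [ofList_odd, hs _ (by omega), hs _ (by omega)]
    · have e : 2 * i + 1 - (2 * (l.length : ℤ) + 2) = 2 * (i - l.length - 1) + 1 := by ring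
      rw [e, ofList_odd, hs' _ (by omega), hs' _ (by omega)]
      congr 2
      ring

/-- Raising one entry also raises the joins with its neighbours, so the loops compare pointwise and
are one homotopy step apart. -/
theorem ofList_comp_of_le {l m : List X} {a b : X} (hab : a ≤ b)
    (ha : IsClosedChain x₀ (l ++ a :: m)) (hb : IsClosedChain x₀ (l ++ b :: m)) :
    Comp (ofList _ ha) (ofList _ hb) := by
  refine Or.inl (zigzagFun_le (fun i => ?_) hb.adj_listSeq)
  rw [listSeq_append_cons, listSeq_append_cons]
  split_ifs
  · exact le_rfl
  · exact hab
  · exact le_rfl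

/-- Repeating the entry `a` is a delay by two units at the time `2 * l.length` of `a`, since the
value inserted between the two copies is `upper a a = a`. -/
theorem ofList_stutter {l m : List X} {a : X} (h : IsClosedChain x₀ (l ++ a :: m))
    (h' : IsClosedChain x₀ (l ++ a :: a :: m)) : Homotopic (ofList _ h) (ofList _ h') := by
  convert delay_homotopic (2 * l.length) (ofList _ h) using 1
  have hs : ∀ i : ℤ, i ≤ l.length →
      listSeq x₀ (l ++ a :: a :: m) i = listSeq x₀ (l ++ a :: m) i := by
    intro i hi
    rw [listSeq_append_cons, listSeq_append_cons]
    split_ifs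
    · rfl
    · rfl
    · omega
  have hs' : ∀ i : ℤ, l.length + 1 ≤ i →
      listSeq x₀ (l ++ a :: a :: m) i = listSeq x₀ (l ++ a :: m) (i - 1) := by
    intro i hi
    rw [listSeq_append_cons, listSeq_append_cons, listSeq_cons]
    split_ifs
    all_goals first | omega | rfl | skip
    congr 1
    ring
  refine ext_of (Zigzag.cases_parity (fun i => ?_) (fun i => ?_))
  · rw [ofList_even, delay_apply]
    split_ifs with h1 h2 <;> dsimp only at *
    · rw [ofList_even, hs _ (by omega)]
    · omega
    · have e : 2 * i - 2 = 2 * (i - 1) := by ring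
      rw [e, ofList_even, hs' _ (by omega)]
  · rw [ofList_odd, delay_apply]
    split_ifs with h1 h2 <;> dsimp only at *
    · rw [ofList_odd, hs _ (by omega), hs _ (by omega)]
    · have e : i = l.length := by omega
      rw [ofList_even, hs _ (by omega), hs' _ (by omega), e, add_sub_cancel_right, upper_self]
    · have e : 2 * i + 1 - 2 = 2 * (i - 1) + 1 := by ring
      rw [e, ofList_odd, hs' _ (by omega), hs' _ (by omega)]
      congr 2
      ring

/-! ### Every loop is homotopic to one that runs through a closed chain. -/

/-- The loop `f`, with the first `n` values at times `1, 3, 5, …` held two units longer. -/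
def holdOdd (f : Loop X x₀) : ℕ → Loop X x₀
  | 0 => f
  | n + 1 => delay (4 * n + 1) (holdOdd f n)

theorem homotopic_holdOdd (f : Loop X x₀) (n : ℕ) : Homotopic f (holdOdd f n) := by
  induction n with
  | zero => exact .refl _
  | succ n ih => exact ih.trans (delay_homotopic _ _)

theorem holdOdd_of_ge (f : Loop X x₀) (n : ℕ) (t : ℤ) (ht : 4 * n ≤ t) :
    holdOdd f n ⟨t⟩ = f ⟨t - 2 * n⟩ := by
  induction n generalizing t with
  | zero => simp [holdOdd]
  | succ n ih =>
    push_cast at ht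
    rw [holdOdd, delay_apply, if_neg (by dsimp only; omega), if_neg (by dsimp only; omega)]
    dsimp only
    rw [ih _ (by omega)]
    congr 2
    push_cast
    ring

theorem holdOdd_of_nonpos (f : Loop X x₀) (n : ℕ) (t : ℤ) (ht : t ≤ 0) :
    holdOdd f n ⟨t⟩ = f ⟨t⟩ := by
  induction n with
  | zero => rfl
  | succ n ih => rw [holdOdd, delay_apply, if_pos (by dsimp only; omega), ih]

/-- Later delays only act after time `4 * m + 1`, so the part up to there is final. -/
theorem holdOdd_stable (f : Loop X x₀) {m n : ℕ} (hmn : m ≤ n) (t : ℤ) (ht : t ≤ 4 * m + 1) :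
    holdOdd f n ⟨t⟩ = holdOdd f m ⟨t⟩ := by
  induction n, hmn using Nat.le_induction with
  | base => rfl
  | succ n hn ih => rw [holdOdd, delay_apply, if_pos (by dsimp only; omega), ih]

theorem holdOdd_four_mul (f : Loop X x₀) {m n : ℕ} (hmn : m ≤ n) :
    holdOdd f n ⟨4 * m⟩ = f ⟨2 * m⟩ := by
  rw [holdOdd_stable f hmn _ (by omega), holdOdd_of_ge _ _ _ le_rfl]
  congr 2
  ring

/-- The slowed loop spends one unit on each even time of `f` and three on each odd time, so the
block of four starting at `4 * m` carries the values of `f` at `2 * m` and `2 * m + 1`. -/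
theorem holdOdd_four_mul_add (f : Loop X x₀) {m n : ℕ} (hmn : m < n) {t : ℤ}
    (h1 : 4 * m + 1 ≤ t) (h2 : t ≤ 4 * m + 3) : holdOdd f n ⟨t⟩ = f ⟨2 * m + 1⟩ := by
  rw [holdOdd_stable f (Nat.succ_le_of_lt hmn) _ (by push_cast; omega), holdOdd, delay_apply]
  split_ifs with h3 h4 <;> dsimp only at *
  · rw [holdOdd_of_ge _ _ _ (by omega)]
    congr 2
    omega
  · rw [holdOdd_of_ge _ _ _ (by omega)]
    congr 2
    omega
  · rw [holdOdd_of_ge _ _ _ (by omega)]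
    congr 2
    omega

/-- Lists are indexed from `0`, so the loop is first moved to nonnegative times by putting the
constant loop before it. -/
theorem exists_homotopic_vanishing (f : Loop X x₀) : ∃ (g : Loop X x₀) (n : ℕ), Homotopic f g ∧
    (∀ t : ℤ, t ≤ 0 → g ⟨t⟩ = x₀) ∧ ∀ t : ℤ, 2 * n ≤ t → g ⟨t⟩ = x₀ := by
  have hf : Fits 0 (2 * f.radius) (const x₀) f :=
    ⟨even_two_mul _, fun _ _ => rfl, fun t ht => f.eq_of_le (by omega)⟩
  refine ⟨concatAt _ _ _ _ hf, 2 * f.radius,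
    (const_mul_homotopic f).symm.trans (mul_homotopic_concatAt hf), fun t ht => ?_, fun t ht => ?_⟩
  · rw [concatAt_apply, if_pos ht]
    rfl
  · rw [concatAt_apply]
    split_ifs
    · rfl
    · exact f.eq_of_ge (by dsimp only; push_cast at ht; omega)

/-- Every loop is homotopic to one that runs through a closed chain. -/
theorem exists_homotopic_ofList (f : Loop X x₀) :
    ∃ (l : List X) (h : IsClosedChain x₀ l), Homotopic f (ofList l h) := by
  obtain ⟨g, n, hfg, h0, hn⟩ := exists_homotopic_vanishing f
  have hadj : ∀ t : ℤ, Adj (g ⟨t⟩) (g ⟨t + 1⟩) := by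
    intro t
    by_cases ht : Even t
    · exact Or.inl ((Zigzag.comparable_succ g.toHom t).1 ht)
    · exact Or.inr ((Zigzag.comparable_succ g.toHom t).2 ht)
  -- All values are recorded, at odd times as well as at even ones; neighbours are comparable
  -- because `g` is order-preserving.
  let l : List X := (List.range (2 * n)).map fun i : ℕ => g ⟨i⟩
  have hseq : ∀ i : ℤ, listSeq x₀ l i = g ⟨i⟩ := by
    intro i
    by_cases h1 : i < 0
    · rw [listSeq_of_neg _ h1, h0 _ h1.le]
    by_cases h2 : 2 * n ≤ i
    · rw [listSeq_of_ge _ (by simpa [l] using h2), hn _ h2]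
    · lift i to ℕ using by omega
      rw [listSeq, if_neg h1, Int.toNat_natCast, List.getD_eq_getElem _ _ (by simp [l]; omega)]
      simp [l]
  have hl : IsClosedChain x₀ l := by
    -- The closed sequence lists the values of `g` at the times `-1, …, 2 * n`.
    have e : x₀ :: (l ++ [x₀]) = (List.range (2 * n + 2)).map fun i : ℕ => g ⟨i - 1⟩ := by
      rw [List.range_succ, List.range_succ_eq_map]
      simp [l, Function.comp_def, h0 (-1) (by norm_num), hn (2 * n) le_rfl]
    rw [IsClosedChain, e, List.isChain_iff_getElem]
    intro i hi
    simp only [List.getElem_map, List.getElem_range]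
    have := hadj (i - 1)
    convert this using 3
    push_cast
    ring
  refine ⟨l, hl, hfg.trans ?_⟩
  -- Between an even and an odd time of `g` the greater value is the odd one. The loop through `l`
  -- therefore shows each odd value three times in a row and each even value once, exactly as
  -- `holdOdd` does. Holds past the end of `g` change nothing.
  convert homotopic_holdOdd g (2 * n) using 1
  refine ext_of fun t => ?_
  obtain ⟨t⟩ := t
  by_cases h1 : t < 0
  · rw [holdOdd_of_nonpos _ _ _ h1.le, h0 _ h1.le]
    rcases Int.even_or_odd' t with ⟨i, rfl | rfl⟩
    · rw [ofList_even, hseq, h0 _ (by omega)]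
    · rw [ofList_odd, hseq, hseq, h0 _ (by omega), h0 _ (by omega), upper_self]
  by_cases h2 : 4 * (2 * n : ℕ) ≤ t
  · rw [holdOdd_of_ge _ _ _ (by exact_mod_cast h2), hn _ (by push_cast at *; omega)]
    rcases Int.even_or_odd' t with ⟨i, rfl | rfl⟩
    · rw [ofList_even, hseq, hn _ (by omega)]
    · rw [ofList_odd, hseq, hseq, hn _ (by omega), hn _ (by omega), upper_self]
  obtain ⟨m, hm⟩ : ∃ m : ℕ, (m : ℤ) = t / 4 := ⟨(t / 4).toNat, by omega⟩
  have hup := Zigzag.comparable_succ g.toHom (2 * m)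
  have hdown := Zigzag.comparable_succ g.toHom (2 * m + 1)
  have h3 : t = 4 * m ∨ t = 4 * m + 1 ∨ t = 4 * m + 2 ∨ t = 4 * m + 3 := by omega
  rcases h3 with rfl | rfl | rfl | rfl
  · rw [holdOdd_four_mul g (by omega), show (4 * m : ℤ) = 2 * (2 * m) by ring, ofList_even, hseq]
  · rw [holdOdd_four_mul_add g (m := m) (by omega) (by omega) (by omega),
      show (4 * m + 1 : ℤ) = 2 * (2 * m) + 1 by ring, ofList_odd, hseq, hseq]
    exact upper_of_le (hup.1 (even_two_mul _))
  · rw [holdOdd_four_mul_add g (m := m) (by omega) (by omega) (by omega),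
      show (4 * m + 2 : ℤ) = 2 * (2 * m + 1) by ring, ofList_even, hseq]
  · rw [holdOdd_four_mul_add g (m := m) (by omega) (by omega) (by omega),
      show (4 * m + 3 : ℤ) = 2 * (2 * m + 1) + 1 by ring, ofList_odd, hseq, hseq]
    exact upper_of_ge (hdown.2 (by simp))

end Loop

/-! ### Homotopy classes of closed chains -/

namespace Pi1

open Classical in
/-- The homotopy class of a closed chain, and `1` for a list that is not a closed chain. -/
noncomputable def ofList (x₀ : X) (l : List X) : Pi1 X x₀ :=
  if h : IsClosedChain x₀ l then mk (Loop.ofList l h) else 1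

theorem ofList_of_closed {l : List X} (h : IsClosedChain x₀ l) :
    ofList x₀ l = mk (Loop.ofList l h) := dif_pos h

theorem ofList_of_not_closed {l : List X} (h : ¬ IsClosedChain x₀ l) : ofList x₀ l = 1 :=
  dif_neg h

theorem exists_eq_ofList (g : Pi1 X x₀) : ∃ l, IsClosedChain x₀ l ∧ g = ofList x₀ l := by
  obtain ⟨f⟩ := g
  obtain ⟨l, h, hf⟩ := f.exists_homotopic_ofList
  exact ⟨l, h, (Quotient.sound hf).trans (ofList_of_closed h).symm⟩

theorem ofList_nil : ofList x₀ [] = 1 := by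
  have h : IsClosedChain x₀ [] := by simp [IsClosedChain, Adj.refl]
  rw [ofList_of_closed h]
  refine congrArg mk (Loop.ext_of (Zigzag.cases_parity (fun i => ?_) fun i => ?_))
  · rw [Loop.ofList_even, listSeq_nil]
    rfl
  · rw [Loop.ofList_odd, listSeq_nil, listSeq_nil, upper_self]
    rfl

end Pi1

theorem isChain_cons_append_cons {l m : List X} {a c : X} :
    List.IsChain Adj (c :: (l ++ a :: m)) ↔
      List.IsChain Adj (c :: (l ++ [a])) ∧ List.IsChain Adj (a :: m) :=
  List.isChain_split (l₁ := c :: l)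

theorem isClosedChain_append_cons {l m : List X} {a : X} : IsClosedChain x₀ (l ++ a :: m) ↔
    List.IsChain Adj (x₀ :: (l ++ [a])) ∧ List.IsChain Adj (a :: (m ++ [x₀])) := by
  rw [IsClosedChain, ← isChain_cons_append_cons, List.append_assoc, List.cons_append]

/-! ### Moves on closed chains that preserve the homotopy class. -/

namespace Pi1

theorem ofList_mul {l m : List X} (hl : IsClosedChain x₀ l) (hm : IsClosedChain x₀ m) :
    ofList x₀ l * ofList x₀ m = ofList x₀ (l ++ x₀ :: m) := by
  have h : IsClosedChain x₀ (l ++ x₀ :: m) := isClosedChain_append_cons.2 ⟨hl, hm⟩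
  rw [ofList_of_closed hl, ofList_of_closed hm, ofList_of_closed h]
  exact Quotient.sound (Loop.ofList_mul hl hm h)

theorem ofList_replace {l m : List X} {a b : X} (hab : Adj a b)
    (ha : IsClosedChain x₀ (l ++ a :: m)) (hb : IsClosedChain x₀ (l ++ b :: m)) :
    ofList x₀ (l ++ a :: m) = ofList x₀ (l ++ b :: m) := by
  rw [ofList_of_closed ha, ofList_of_closed hb]
  rcases hab with hab | hab
  · exact Quotient.sound (Loop.ofList_comp_of_le hab ha hb).homotopic
  · exact Quotient.sound (Loop.ofList_comp_of_le hab hb ha).homotopic.symm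

theorem ofList_stutter {l m : List X} {a : X} (h : IsClosedChain x₀ (l ++ a :: m)) :
    ofList x₀ (l ++ a :: a :: m) = ofList x₀ (l ++ a :: m) := by
  have h' : IsClosedChain x₀ (l ++ a :: a :: m) := by
    rw [isClosedChain_append_cons] at h ⊢
    exact ⟨h.1, List.isChain_cons_cons.2 ⟨Adj.refl a, h.2⟩⟩
  rw [ofList_of_closed h, ofList_of_closed h']
  exact (Quotient.sound (Loop.ofList_stutter h h')).symm

/-- Going from `a` to `b` and back can be cancelled. -/
theorem ofList_backtrack {l m : List X} {a b : X} (hab : Adj a b)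
    (h : IsClosedChain x₀ (l ++ a :: m)) :
    ofList x₀ (l ++ a :: b :: a :: m) = ofList x₀ (l ++ a :: m) := by
  obtain ⟨h1, h2⟩ := isClosedChain_append_cons.1 h
  have h3 : IsClosedChain x₀ (l ++ a :: a :: m) :=
    isClosedChain_append_cons.2 ⟨h1, List.isChain_cons_cons.2 ⟨Adj.refl a, h2⟩⟩
  have h4 : IsClosedChain x₀ (l ++ a :: a :: a :: m) := isClosedChain_append_cons.2
    ⟨h1, List.isChain_cons_cons.2 ⟨Adj.refl a, List.isChain_cons_cons.2 ⟨Adj.refl a, h2⟩⟩⟩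
  have h5 : IsClosedChain x₀ (l ++ a :: b :: a :: m) := isClosedChain_append_cons.2
    ⟨h1, List.isChain_cons_cons.2 ⟨hab, List.isChain_cons_cons.2 ⟨hab.symm, h2⟩⟩⟩
  -- The target `a` is expanded to `a, a, a`, whose middle entry may be exchanged for the comparable
  -- `b`.
  rw [← ofList_stutter h, ← ofList_stutter h3]
  have := ofList_replace (l := l ++ [a]) (m := a :: m) hab.symm (by simpa using h5)
    (by simpa using h4)
  simpa using this

/-- The middle of three increasing elements can be left out. -/
theorem ofList_shortcut {l m : List X} {a b c : X} (hab : a ≤ b) (hbc : b ≤ c)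
    (h : IsClosedChain x₀ (l ++ a :: c :: m)) :
    ofList x₀ (l ++ a :: b :: c :: m) = ofList x₀ (l ++ a :: c :: m) := by
  obtain ⟨h1, h2⟩ := isClosedChain_append_cons.1 h
  have h3 := (List.isChain_cons_cons.1 h2).2
  have h4 : IsClosedChain x₀ (l ++ a :: c :: c :: m) := isClosedChain_append_cons.2
    ⟨h1, List.isChain_cons_cons.2
      ⟨Or.inl (hab.trans hbc), List.isChain_cons_cons.2 ⟨Adj.refl c, h3⟩⟩⟩
  have h5 : IsClosedChain x₀ (l ++ a :: b :: c :: m) := isClosedChain_append_cons.2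
    ⟨h1, List.isChain_cons_cons.2 ⟨Or.inl hab, List.isChain_cons_cons.2 ⟨Or.inl hbc, h3⟩⟩⟩
  -- Replace `b` by `c`, then drop the repetition of `c`.
  have h6 := ofList_replace (l := l ++ [a]) (m := c :: m) (Or.inl hbc : Adj b c)
    (by simpa using h5) (by simpa using h4)
  have h7 := ofList_stutter (l := l ++ [a]) (a := c) (m := m) (by simpa using h)
  simp only [List.append_assoc, List.cons_append, List.nil_append] at h6 h7
  exact h6.trans h7

/-- Going from `b` along a chain and back the same way can be cancelled. -/
theorem ofList_spur {l m w : List X} {b c : X} (hw : List.IsChain Adj (c :: (w ++ [b])))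
    (h : IsClosedChain x₀ (l ++ b :: m)) :
    ofList x₀ (l ++ b :: (w.reverse ++ c :: (w ++ b :: m))) = ofList x₀ (l ++ b :: m) := by
  induction w generalizing c with
  | nil =>
    have hcb : Adj c b := by simpa using hw
    simpa using ofList_backtrack hcb.symm h
  | cons d w ih =>
    obtain ⟨hcd, hd⟩ := List.isChain_cons_cons.1 hw
    -- By induction the spur that turns around at `d` is trivial; the given one only adds the
    -- backtrack `d, c, d` at its tip.
    rw [← ih hd]
    obtain ⟨h1, h2⟩ := isClosedChain_append_cons.1 h
    have hd' : List.IsChain Adj (b :: (w.reverse ++ [d])) := by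
      have := List.isChain_reverse.2 (hd.imp fun _ _ => Adj.symm)
      simpa using this
    have h3 : IsClosedChain x₀ ((l ++ b :: w.reverse) ++ d :: (w ++ b :: m)) := by
      refine isClosedChain_append_cons.2 ⟨?_, ?_⟩
      · have := isChain_cons_append_cons.2 ⟨h1, hd'⟩
        simpa using this
      · have := isChain_cons_append_cons.2 ⟨hd, h2⟩
        simpa using this
    have := ofList_backtrack hcd.symm h3
    simpa using this

/-- A closed chain through `b` is a product, given a chain `w` from the base point to `b`. -/
theorem ofList_split {l m w : List X} {b : X} (hw : List.IsChain Adj (x₀ :: (w ++ [b])))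
    (h : IsClosedChain x₀ (l ++ b :: m)) :
    ofList x₀ (l ++ b :: m) = ofList x₀ (l ++ b :: w.reverse) * ofList x₀ (w ++ b :: m) := by
  obtain ⟨h1, h2⟩ := isClosedChain_append_cons.1 h
  have hw' : List.IsChain Adj (b :: (w.reverse ++ [x₀])) := by
    have := List.isChain_reverse.2 (hw.imp fun _ _ => Adj.symm)
    simpa using this
  -- At `b`, insert the spur that runs to `x₀` along the reverse of `w` and back. The `x₀` at its
  -- tip is where the product is cut.
  rw [ofList_mul (isClosedChain_append_cons.2 ⟨h1, hw'⟩) (isClosedChain_append_cons.2 ⟨hw, h2⟩),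
    ← ofList_spur hw h]
  simp

end Pi1

/-! ### Chosen chains from the base point. -/

/-- The element `a` can be reached from the base point by a chain of comparable elements. -/
def Reachable (x₀ a : X) : Prop := ∃ l, List.IsChain Adj (x₀ :: (l ++ [a]))

theorem Reachable.adj {a b : X} (h : Reachable x₀ a) (hab : Adj a b) : Reachable x₀ b := by
  obtain ⟨l, hl⟩ := h
  refine ⟨l ++ [a], ?_⟩
  have := isChain_cons_append_cons.2 ⟨hl, show List.IsChain Adj [a, b] by simpa using hab⟩
  simpa using this

/-- The reachable elements and the unreachable ones both form lower sets, since reachability passes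
along comparabilities in either direction; so the set is clopen, and it contains `x₀`. -/
theorem reachable_of_connected (h : ConnectedSpace (Topology.WithLowerSet X)) (a : X) :
    Reachable x₀ a := by
  let S : Set (Topology.WithLowerSet X) := {b | Reachable x₀ (Topology.WithLowerSet.ofLowerSet b)}
  have hS : IsClopen S := by
    constructor
    · rw [← isOpen_compl_iff, Topology.IsLowerSet.isOpen_iff_isLowerSet]
      intro b c hcb hb hc
      exact hb (hc.adj (Or.inl hcb))
    · rw [Topology.IsLowerSet.isOpen_iff_isLowerSet]
      intro b c hcb hb
      exact Reachable.adj hb (Or.inr hcb)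
  have hx : Topology.WithLowerSet.toLowerSet x₀ ∈ S := ⟨[], by simp [Adj.refl]⟩
  have := hS.eq_univ ⟨_, hx⟩
  have ha : Topology.WithLowerSet.toLowerSet a ∈ S := this ▸ Set.mem_univ _
  exact ha

open Classical in
/-- The inner members of a chosen chain of comparable elements from the base point to `a`. -/
noncomputable def chainTo (x₀ a : X) : List X :=
  if a = x₀ then [] else if h : Reachable x₀ a then h.choose else []

theorem chainTo_self : chainTo x₀ x₀ = [] := if_pos rfl

theorem isChain_chainTo {a : X} (h : Reachable x₀ a) :
    List.IsChain Adj (x₀ :: (chainTo x₀ a ++ [a])) := by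
  unfold chainTo
  split_ifs with h1
  · subst h1
    simp [Adj.refl]
  · exact h.choose_spec

theorem isChain_chainTo_reverse {a : X} (h : Reachable x₀ a) :
    List.IsChain Adj (a :: ((chainTo x₀ a).reverse ++ [x₀])) := by
  have := List.isChain_reverse.2 ((isChain_chainTo h).imp fun _ _ => Adj.symm)
  simpa using this

/-! ### Classes of edge loops and their relations. -/

namespace Pi1

/-- The class of the loop that goes to `a` along the chosen chain, on to `b`, and back. -/
noncomputable def ofEdge (x₀ a b : X) : Pi1 X x₀ :=
  ofList x₀ (chainTo x₀ a ++ a :: b :: (chainTo x₀ b).reverse)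

/-- With this default value the relations below hold in every component of `X`, so the computation
of the kernel does not need connectedness. -/
theorem ofEdge_of_not_reachable {a b : X} (h : ¬ Reachable x₀ a) : ofEdge x₀ a b = 1 :=
  ofList_of_not_closed fun hc => h ⟨_, (isClosedChain_append_cons.1 hc).1⟩

theorem isClosedChain_edge {a b : X} (h : Reachable x₀ a) (hab : Adj a b) :
    IsClosedChain x₀ (chainTo x₀ a ++ a :: b :: (chainTo x₀ b).reverse) :=
  isClosedChain_append_cons.2 ⟨isChain_chainTo h,
    List.isChain_cons_cons.2 ⟨hab, isChain_chainTo_reverse (h.adj hab)⟩⟩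

/-- The return along the chain of `b` cancels against the way out along the same chain, by
`ofList_split`. -/
theorem ofEdge_mul_ofEdge {a b c : X} (h : Reachable x₀ a) (hab : Adj a b) (hbc : Adj b c) :
    ofEdge x₀ a b * ofEdge x₀ b c =
      ofList x₀ (chainTo x₀ a ++ a :: b :: c :: (chainTo x₀ c).reverse) := by
  have hb := h.adj hab
  have h1 : IsClosedChain x₀ ((chainTo x₀ a ++ [a]) ++ b :: c :: (chainTo x₀ c).reverse) := by
    rw [List.append_assoc]
    exact isClosedChain_append_cons.2 ⟨isChain_chainTo h, List.isChain_cons_cons.2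
      ⟨hab, List.isChain_cons_cons.2 ⟨hbc, isChain_chainTo_reverse (hb.adj hbc)⟩⟩⟩
  have := ofList_split (isChain_chainTo hb) h1
  simp only [List.append_assoc, List.cons_append, List.nil_append] at this
  exact this.symm

theorem ofList_chainTo {a : X} (h : Reachable x₀ a) :
    ofList x₀ (chainTo x₀ a ++ a :: (chainTo x₀ a).reverse) = 1 := by
  have h1 := isChain_chainTo h
  -- Splitting this loop at `a` along the same chain shows that its class equals its own square.
  exact left_eq_mul.1 (ofList_split h1
    (isClosedChain_append_cons.2 ⟨h1, isChain_chainTo_reverse h⟩))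

theorem ofEdge_self (a : X) : ofEdge x₀ a a = 1 := by
  by_cases h : Reachable x₀ a
  · rw [ofEdge, ofList_stutter (isClosedChain_append_cons.2
      ⟨isChain_chainTo h, isChain_chainTo_reverse h⟩), ofList_chainTo h]
  · exact ofEdge_of_not_reachable h

/-- This relation makes both sides of a square agree with its diagonal, and so makes `closeUp`
vanish on boundaries. -/
theorem ofEdge_mul_of_le {a b c : X} (hab : a ≤ b) (hbc : b ≤ c) :
    ofEdge x₀ a b * ofEdge x₀ b c = ofEdge x₀ a c := by
  by_cases h : Reachable x₀ a
  · rw [ofEdge_mul_ofEdge h (Or.inl hab) (Or.inl hbc),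
      ofList_shortcut hab hbc (isClosedChain_edge h (Or.inl (hab.trans hbc)))]
    rfl
  · rw [ofEdge_of_not_reachable h, ofEdge_of_not_reachable h, ofEdge_of_not_reachable, one_mul]
    exact fun hb => h (hb.adj (Or.inr hab))

theorem ofEdge_mul_symm {a b : X} (hab : Adj a b) : ofEdge x₀ a b * ofEdge x₀ b a = 1 := by
  by_cases h : Reachable x₀ a
  · rw [ofEdge_mul_ofEdge h hab hab.symm, ofList_backtrack hab (isClosedChain_append_cons.2
      ⟨isChain_chainTo h, isChain_chainTo_reverse h⟩), ofList_chainTo h]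
  · rw [ofEdge_of_not_reachable h, ofEdge_of_not_reachable, one_mul]
    exact fun hb => h (hb.adj hab.symm)

end Pi1

/-! ### Chains of paths -/

/-- The `1`-cube of two elements `a ≤ b`. -/
def cubeOfLE {a b : X} (h : a ≤ b) : Cube X 1 where
  toFun y := if y 0 = true then b else a
  monotone' y z hyz := by
    have h0 := hyz 0
    cases hy : y 0 <;> cases hz : z 0 <;>
      simp only [hy, hz, if_true, Bool.false_eq_true, if_false, le_refl]
    · exact h
    · exact absurd (hy ▸ hz ▸ h0) (by decide)

theorem cubeOfLE_endpoints (σ : Cube X 1) (h : σ (fun _ => false) ≤ σ fun _ => true) :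
    cubeOfLE h = σ := by
  refine OrderHom.ext _ _ (funext fun y => ?_)
  have hy : y = fun _ => y 0 := funext fun i => by rw [Fin.fin_one_eq_zero i]
  rw [hy]
  cases y 0 <;> rfl

theorem endpoints_le (σ : Cube X 1) : σ (fun _ => false) ≤ σ fun _ => true :=
  σ.monotone fun _ => Bool.false_le _

theorem cubeChain_cubeOfLE_self {a : X} (h : a ≤ a) : cubeChain (cubeOfLE h) = 0 := by
  have key : ∀ y, cubeOfLE h y = a := fun y => ite_self a
  refine cubeChain_eq_zero ⟨0, OrderHom.ext _ _ (funext fun y => ?_)⟩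
  rw [face_apply, face_apply, key, key]

open Classical in
/-- The `1`-chain traversed by a step from `a` to a comparable element `b`. -/
noncomputable def edgeOf (a b : X) : Chain X 1 :=
  if h : a ≤ b then cubeChain (cubeOfLE h) else if h : b ≤ a then -cubeChain (cubeOfLE h) else 0

theorem edgeOf_of_le {a b : X} (h : a ≤ b) : edgeOf a b = cubeChain (cubeOfLE h) := dif_pos h

theorem edgeOf_self (a : X) : edgeOf a a = 0 := by
  rw [edgeOf_of_le le_rfl, cubeChain_cubeOfLE_self]

theorem edgeOf_symm (a b : X) : edgeOf b a = -edgeOf a b := by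
  by_cases h : a ≤ b
  · by_cases h' : b ≤ a
    · rw [le_antisymm h h', edgeOf_self, neg_zero]
    · rw [edgeOf_of_le h, edgeOf, dif_neg h', dif_pos h]
  · by_cases h' : b ≤ a
    · rw [edgeOf_of_le h', edgeOf, dif_neg h, dif_pos h', neg_neg]
    · rw [edgeOf, edgeOf, dif_neg h, dif_neg h', dif_neg h, dif_neg h', neg_zero]

/-- One of the two steps is constant, hence degenerate; the joins inserted by `zigzagFun` thus do
not affect chains. -/
theorem edgeOf_upper {a b : X} (h : Adj a b) :
    edgeOf a (upper a b) + edgeOf (upper a b) b = edgeOf a b := by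
  rcases h with h | h
  · rw [upper_of_le h, edgeOf_self, add_zero]
  · rw [upper_of_ge h, edgeOf_self, zero_add]

theorem edgeChain_eq_edgeOf (f : Zigzag →o X) (x : ℤ) :
    edgeChain f x = edgeOf (f ⟨x⟩) (f ⟨x + 1⟩) := by
  by_cases hx : Even x
  · rw [edgeOf_of_le ((Zigzag.comparable_succ f x).1 hx), edgeChain, if_pos hx, one_smul]
    refine congrArg cubeChain (OrderHom.ext _ _ (funext fun y => ?_))
    change f (if (y 0 = true ↔ Even x) then _ else _) = if y 0 = true then _ else _
    cases y 0 <;> simp [hx]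
  · rw [edgeOf_symm, edgeOf_of_le ((Zigzag.comparable_succ f x).2 hx), edgeChain, if_neg hx,
      neg_smul, one_smul]
    refine congrArg (fun σ => -cubeChain σ) (OrderHom.ext _ _ (funext fun y => ?_))
    change f (if (y 0 = true ↔ Even x) then _ else _) = if y 0 = true then _ else _
    cases y 0 <;> simp [hx]

/-- The `1`-chain traversed by the path from `a` through the members of a list. -/
noncomputable def walkChain : X → List X → Chain X 1
  | _, [] => 0
  | a, b :: l => edgeOf a b + walkChain b l

theorem walkChain_append (a b : X) (l m : List X) :
    walkChain a (l ++ b :: m) = walkChain a (l ++ [b]) + walkChain b m := by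
  induction l generalizing a with
  | nil => simp [walkChain]
  | cons c l ih => simp only [List.cons_append, walkChain, ih c, add_assoc]

theorem walkChain_reverse (a b : X) (l : List X) :
    walkChain b (l.reverse ++ [a]) = -walkChain a (l ++ [b]) := by
  induction l generalizing a with
  | nil => simp [walkChain, edgeOf_symm a b]
  | cons c l ih =>
    rw [List.reverse_cons, List.append_assoc, List.singleton_append, walkChain_append, ih c]
    simp only [List.cons_append, walkChain, edgeOf_symm a c]
    abel

theorem walkChain_eq_sum (d a : X) (l : List X) : walkChain a l =
    ∑ k ∈ Finset.range l.length, edgeOf ((a :: l).getD k d) (l.getD k d) := by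
  induction l generalizing a with
  | nil => rfl
  | cons b l ih =>
    rw [List.length_cons, Finset.sum_range_succ', walkChain, ih b, add_comm]
    rfl

/-- Each step of the list takes two units of time, and the two edge chains add up to that of the
step by `edgeOf_upper`. -/
theorem Loop.loopChain_ofList {l : List X} (h : IsClosedChain x₀ l) :
    loopChain (Loop.ofList l h) = walkChain x₀ (l ++ [x₀]) := by
  let E : ℤ → Chain X 1 := fun x => edgeChain (Loop.ofList l h).toHom x
  have hE : ∀ x : ℤ, x + 1 ≤ -2 ∨ 2 * (l.length : ℤ) ≤ x → E x = 0 := by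
    rintro x (hx | hx) <;> refine edgeChain_eq_zero ?_
    · exact (Loop.ofList_of_nonpos h (by dsimp only; omega)).trans
        (Loop.ofList_of_nonpos h (by dsimp only; omega)).symm
    · exact (Loop.ofList_of_ge h (by dsimp only; omega)).trans
        (Loop.ofList_of_ge h (by dsimp only; omega)).symm
  -- The step from `x₀` to the first entry begins at time `-2`, and there are `l.length + 1` steps
  -- in all.
  have h1 : loopChain (Loop.ofList l h) =
      ∑ k ∈ Finset.range (2 * (l.length + 1)), E ((k : ℤ) - 2) := by
    rw [Loop.loopChain_eq_finsum, finsum_eq_sum_of_support_subset E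
      (s := (Finset.range (2 * (l.length + 1))).image fun k : ℕ => (k : ℤ) - 2), Finset.sum_image]
    · intro a _ b _ hab
      dsimp only at hab
      omega
    · intro x hx
      have h2 : ¬ (x + 1 ≤ -2 ∨ 2 * (l.length : ℤ) ≤ x) := fun h => hx (hE x h)
      simp only [Finset.coe_image, Finset.coe_range, Set.mem_image, Set.mem_Iio]
      exact ⟨(x + 2).toNat, by omega, by omega⟩
  have h2 : ∀ i : ℤ, E (2 * i) + E (2 * i + 1) =
      edgeOf (listSeq x₀ l i) (listSeq x₀ l (i + 1)) := by
    intro i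
    have e : 2 * i + 1 + 1 = 2 * (i + 1) := by ring
    have e0 := Loop.ofList_even h i
    have e1 := Loop.ofList_odd h i
    have e2 := Loop.ofList_even h (i + 1)
    simp only [E, edgeChain_eq_edgeOf, e, e0, e1, e2]
    exact edgeOf_upper (h.adj_listSeq i)
  have h3 : ∀ n : ℕ, ∑ k ∈ Finset.range (2 * n), E ((k : ℤ) - 2) =
      ∑ k ∈ Finset.range n, edgeOf (listSeq x₀ l (k - 1)) (listSeq x₀ l k) := by
    intro n
    induction n with
    | zero => rfl
    | succ n ih =>
      rw [mul_add, mul_one, Finset.sum_range_succ, Finset.sum_range_succ, Finset.sum_range_succ, ih,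
        add_assoc]
      congr 1
      have := h2 (n - 1)
      rw [sub_add_cancel] at this
      rw [← this]
      congr 2 <;> push_cast <;> ring
  rw [h1, h3, walkChain_eq_sum x₀, List.length_append, List.length_singleton]
  have key : ∀ k : ℕ, listSeq x₀ l k = (l ++ [x₀]).getD k x₀ := by
    intro k
    rw [listSeq, if_neg (by omega), Int.toNat_natCast]
    by_cases hk : k < l.length
    · rw [List.getD_append _ _ _ _ hk]
    · rw [List.getD_append_right _ _ _ _ (by omega), List.getD_eq_default _ _ (by omega)]
      cases k - l.length <;> simp
  refine Finset.sum_congr rfl fun k _ => ?_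
  rw [key]
  congr 1
  cases k with
  | zero => exact listSeq_of_neg _ (by simp)
  | succ k =>
    rw [List.getD_cons_succ, ← key]
    congr 1
    push_cast
    ring

/-! ### The inverse of the Hurewicz map -/

namespace Pi1

/-- The class of the edge loop of two elements in the abelianization, written additively. -/
noncomputable def abEdge (x₀ a b : X) : Additive (Abelianization (Pi1 X x₀)) :=
  Additive.ofMul (Abelianization.of (ofEdge x₀ a b))

theorem abEdge_self (a : X) : abEdge x₀ a a = 0 := by
  rw [abEdge, ofEdge_self, map_one, ofMul_one]

theorem abEdge_add_of_le {a b c : X} (hab : a ≤ b) (hbc : b ≤ c) :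
    abEdge x₀ a b + abEdge x₀ b c = abEdge x₀ a c := by
  rw [abEdge, abEdge, abEdge, ← ofMul_mul, ← map_mul, ofEdge_mul_of_le hab hbc]

theorem abEdge_symm {a b : X} (hab : Adj a b) : abEdge x₀ b a = -abEdge x₀ a b := by
  rw [eq_neg_iff_add_eq_zero, abEdge, abEdge, ← ofMul_mul, ← map_mul, ofEdge_mul_symm hab.symm,
    map_one, ofMul_one]

end Pi1

/-- The homomorphism from `1`-chains to the abelianization of `π₁ᴰ(X, x₀)` that closes up every
`1`-cube along the chosen chains. -/
noncomputable def closeUp (X : Type*) [PartialOrder X] (x₀ : X) :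
    Chain X 1 →+ Additive (Abelianization (Pi1 X x₀)) :=
  QuotientAddGroup.lift (degenerateChains X 1)
    (FreeAbelianGroup.lift fun σ : Cube X 1 =>
      Pi1.abEdge x₀ (σ fun _ => false) (σ fun _ => true)) <| by
    rw [degenerateChains, AddSubgroup.closure_le]
    rintro _ ⟨σ, ⟨i, hi⟩, rfl⟩
    rw [Fin.fin_one_eq_zero i] at hi
    -- The two faces of a `1`-cube are its endpoints, so a degenerate one has equal endpoints.
    have h := DFunLike.congr_fun hi finZeroElim
    rw [face_apply, face_apply] at h
    have e : ∀ ε : Bool, (Fin.insertNth (α := fun _ => Bool) (0 : Fin 1) ε finZeroElim) =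
        fun _ => ε := fun ε => funext fun i => by rw [Fin.fin_one_eq_zero i]; simp
    rw [e, e] at h
    rw [SetLike.mem_coe, AddMonoidHom.mem_ker, FreeAbelianGroup.lift_apply_of, h]
    exact Pi1.abEdge_self _

theorem closeUp_cubeChain (σ : Cube X 1) : closeUp X x₀ (cubeChain σ) =
    Pi1.abEdge x₀ (σ fun _ => false) (σ fun _ => true) := by
  change FreeAbelianGroup.lift _ (FreeAbelianGroup.of σ) = _
  rw [FreeAbelianGroup.lift_apply_of]

theorem closeUp_edgeOf {a b : X} (h : Adj a b) :
    closeUp X x₀ (edgeOf a b) = Pi1.abEdge x₀ a b := by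
  have key : ∀ {a b : X} (h : a ≤ b), closeUp X x₀ (edgeOf a b) = Pi1.abEdge x₀ a b :=
    fun h => by
      rw [edgeOf_of_le h, closeUp_cubeChain]
      rfl
  rcases h with h | h
  · exact key h
  · rw [edgeOf_symm, map_neg, key h, Pi1.abEdge_symm (Or.inl h)]

/-- Induction on chains, starting from cubes. -/
theorem Chain.induction_on {n : ℕ} {p : Chain X n → Prop} (c : Chain X n) (zero : p 0)
    (cube : ∀ σ, p (cubeChain σ)) (neg : ∀ c, p c → p (-c))
    (add : ∀ c d, p c → p d → p (c + d)) : p c := by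
  obtain ⟨c, rfl⟩ := QuotientAddGroup.mk_surjective c
  induction c using FreeAbelianGroup.induction_on with
  | zero => exact zero
  | of σ => exact cube σ
  | neg σ h => exact neg _ h
  | add a b ha hb => exact add _ _ ha hb

/-- The boundary of a `2`-cube is the path from the least to the greatest corner through one middle
corner, minus the path through the other. By `abEdge_add_of_le` each of them has the value of the
diagonal. -/
theorem closeUp_boundary (c : Chain X 2) : closeUp X x₀ (boundary X 1 c) = 0 := by
  induction c using Chain.induction_on with
  | zero => rw [map_zero, map_zero]
  | neg c h => rw [map_neg, map_neg, h, neg_zero]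
  | add c d hc hd => rw [map_add, map_add, hc, hd, add_zero]
  | cube σ =>
    have e0 : ∀ ε δ : Bool, face 0 ε σ (fun _ => δ) = σ ![ε, δ] := fun ε δ => by
      rw [face_apply]
      congr 1
      funext i
      fin_cases i <;> rfl
    have e1 : ∀ ε δ : Bool, face 1 ε σ (fun _ => δ) = σ ![δ, ε] := fun ε δ => by
      rw [face_apply]
      congr 1
      funext i
      fin_cases i <;> rfl
    have hle : ∀ {a b c d : Bool}, a ≤ c → b ≤ d → σ ![a, b] ≤ σ ![c, d] := by
      intro a b c d h1 h2
      refine σ.monotone fun i => ?_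
      fin_cases i
      · exact h1
      · exact h2
    rw [boundary_cubeChain, Fin.sum_univ_two, map_add, map_zsmul, map_zsmul, map_sub, map_sub]
    simp only [closeUp_cubeChain, e0, e1]
    have h1 := Pi1.abEdge_add_of_le (x₀ := x₀) (hle (a := false) (b := false) (c := false)
      (d := true) le_rfl (Bool.false_le _)) (hle (c := true) (d := true) (Bool.false_le _) le_rfl)
    have h2 := Pi1.abEdge_add_of_le (x₀ := x₀) (hle (a := false) (b := false) (c := true)
      (d := false) (Bool.false_le _) le_rfl) (hle (c := true) (d := true) le_rfl (Bool.false_le _))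
    simp only [Fin.val_zero, Fin.val_one, zero_add, pow_one, neg_smul, one_smul, one_add_one_eq_two,
      even_two, Even.neg_pow, one_pow]
    linear_combination (norm := module) h2 - h1

/-- Peel off the first edge: `ofList_split` at the next element `c`, along the chosen chain to `c`,
separates the loop of that edge from the loop of the remaining walk. -/
theorem closeUp_walkChain {a b : X} (w : List X) (ha : Reachable x₀ a)
    (hw : List.IsChain Adj (a :: (w ++ [b]))) :
    closeUp X x₀ (walkChain a (w ++ [b])) = Additive.ofMul (Abelianization.of
      (Pi1.ofList x₀ (chainTo x₀ a ++ a :: (w ++ b :: (chainTo x₀ b).reverse)))) := by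
  induction w generalizing a with
  | nil =>
    have hab : Adj a b := by simpa using hw
    simp only [List.nil_append, walkChain, add_zero]
    exact closeUp_edgeOf hab
  | cons c w ih =>
    obtain ⟨hac, hc⟩ := List.isChain_cons_cons.1 hw
    have hrc := ha.adj hac
    have hrb : Reachable x₀ b := by
      refine ⟨chainTo x₀ a ++ a :: (c :: w), ?_⟩
      have := isChain_cons_append_cons.2 ⟨isChain_chainTo ha, hw⟩
      simpa using this
    have h1 : IsClosedChain x₀ ((chainTo x₀ a ++ [a]) ++
        c :: (w ++ b :: (chainTo x₀ b).reverse)) := by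
      rw [List.append_assoc]
      refine isClosedChain_append_cons.2 ⟨isChain_chainTo ha, List.isChain_cons_cons.2 ⟨hac, ?_⟩⟩
      have := isChain_cons_append_cons.2 ⟨hc, isChain_chainTo_reverse hrb⟩
      simpa using this
    have h2 := Pi1.ofList_split (isChain_chainTo hrc) h1
    simp only [List.append_assoc, List.cons_append, List.nil_append] at h2 ⊢
    rw [walkChain, map_add, closeUp_edgeOf hac, ih hrc hc, h2, map_mul, ofMul_mul]
    rfl

theorem closeUp_loopChain_ofList {l : List X} (h : IsClosedChain x₀ l) :
    closeUp X x₀ (loopChain (Loop.ofList l h)) =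
      Additive.ofMul (Abelianization.of (Pi1.ofList x₀ l)) := by
  have hnil : IsClosedChain x₀ [] := by simp [IsClosedChain, Adj.refl]
  have h1 : IsClosedChain x₀ (l ++ x₀ :: []) := isClosedChain_append_cons.2 ⟨h, hnil⟩
  -- The chosen chain to `x₀` is empty, so the lemma yields `l` with one `x₀` on either side, which
  -- is the product of the classes of `[]`, `l` and `[]`.
  rw [Loop.loopChain_ofList, closeUp_walkChain l ⟨[], hnil⟩ h, chainTo_self, List.reverse_nil,
    ← Pi1.ofList_mul hnil h1, ← Pi1.ofList_mul h hnil, Pi1.ofList_nil, one_mul, mul_one]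

theorem hurewicz_ofList {l : List X} (h : IsClosedChain x₀ l) :
    hurewicz X x₀ (Pi1.ofList x₀ l) = Multiplicative.ofAdd (QuotientAddGroup.mk
      (⟨loopChain (Loop.ofList l h), Loop.loopChain_mem_cycles _⟩ : cycles X 1)) := by
  rw [Pi1.ofList_of_closed h, hurewicz_mk]

/-- Commutators die because the target is abelian. Conversely, if the chain of a loop bounds,
`closeUp` sends it both to `0` and to the class of the loop in the abelianization. -/
theorem ker_hurewicz (x₀ : X) : (hurewicz X x₀).ker = commutator (Pi1 X x₀) := by
  refine le_antisymm (fun g hg => ?_) (Abelianization.commutator_subset_ker _)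
  obtain ⟨l, h, rfl⟩ := g.exists_eq_ofList
  rw [MonoidHom.mem_ker, hurewicz_ofList h, ofAdd_eq_one, QuotientAddGroup.eq_zero_iff,
    AddSubgroup.mem_addSubgroupOf] at hg
  obtain ⟨c, hc⟩ := hg
  change boundary X 1 c = loopChain (Loop.ofList l h) at hc
  have h1 := closeUp_loopChain_ofList h
  rw [← hc, closeUp_boundary] at h1
  rw [← Abelianization.ker_of, MonoidHom.mem_ker]
  exact (ofMul_eq_zero.1 h1.symm)

/-! ### Surjectivity. -/

/-- The homomorphism that sends a point to the chosen path from the base point to it. -/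
noncomputable def conePath (X : Type*) [PartialOrder X] (x₀ : X) : Chain X 0 →+ Chain X 1 :=
  QuotientAddGroup.lift (degenerateChains X 0)
    (FreeAbelianGroup.lift fun σ : Cube X 0 =>
      walkChain x₀ (chainTo x₀ (σ finZeroElim) ++ [σ finZeroElim])) <| by
    rw [degenerateChains, AddSubgroup.closure_le]
    rintro _ ⟨σ, hσ, rfl⟩
    exact hσ.elim

theorem conePath_cubeChain (σ : Cube X 0) : conePath X x₀ (cubeChain σ) =
    walkChain x₀ (chainTo x₀ (σ finZeroElim) ++ [σ finZeroElim]) := by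
  change FreeAbelianGroup.lift _ (FreeAbelianGroup.of σ) = _
  rw [FreeAbelianGroup.lift_apply_of]

/-- Every `1`-chain is, up to the cone on its boundary, the chain of a loop. -/
theorem exists_hurewicz_eq (hX : ∀ a, Reachable x₀ a) (c : Chain X 1) :
    ∃ (g : Pi1 X x₀) (z : cycles X 1), (z : Chain X 1) = c - conePath X x₀ (boundary X 0 c) ∧
      hurewicz X x₀ g = Multiplicative.ofAdd (QuotientAddGroup.mk z) := by
  induction c using Chain.induction_on with
  | zero => exact ⟨1, 0, by simp, by rw [map_one]; rfl⟩
  | neg c h =>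
    obtain ⟨g, z, hz, hg⟩ := h
    refine ⟨g⁻¹, -z, ?_, by rw [map_inv, hg]; rfl⟩
    rw [AddSubgroup.coe_neg, hz, map_neg, map_neg]
    abel
  | add c d hc hd =>
    obtain ⟨g, z, hz, hg⟩ := hc
    obtain ⟨g', z', hz', hg'⟩ := hd
    refine ⟨g * g', z + z', ?_, by rw [map_mul, hg, hg']; rfl⟩
    rw [AddSubgroup.coe_add, hz, hz', map_add, map_add]
    abel
  | cube σ =>
    have hab := endpoints_le σ
    have h := Pi1.isClosedChain_edge (hX (σ fun _ => false)) (Or.inl hab)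
    -- The witnesses are the class of the edge loop of the two endpoints and the chain of that loop.
    refine ⟨_, _, ?_, hurewicz_ofList h⟩
    have e : ∀ ε : Bool, face 0 ε σ finZeroElim = σ fun _ => ε := fun ε => by
      rw [face_apply]
      congr 1
      funext i
      rw [Fin.fin_one_eq_zero i]
      simp
    change loopChain (Loop.ofList _ h) = _
    -- The walk consists of the chosen path to the lower endpoint, the cube, and the reverse of the
    -- chosen path to the upper endpoint. The boundary of the cube is upper minus lower endpoint, so
    -- the two paths amount to subtracting the cone on it.
    rw [Loop.loopChain_ofList, List.append_assoc, List.cons_append, List.cons_append,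
      walkChain_append, walkChain, walkChain_reverse, edgeOf_of_le hab, cubeOfLE_endpoints,
      boundary_cubeChain, Fin.sum_univ_one, map_zsmul, map_sub, conePath_cubeChain,
      conePath_cubeChain, e, e]
    simp only [Fin.val_zero, zero_add, pow_one, neg_smul, one_smul]
    abel

/-- For a cycle the cone term in `exists_hurewicz_eq` vanishes. -/
theorem hurewicz_surjective (hX : ∀ a, Reachable x₀ a) :
    Function.Surjective (hurewicz X x₀) := by
  intro y
  obtain ⟨y, rfl⟩ := Multiplicative.ofAdd.surjective y
  obtain ⟨⟨c, hc⟩, rfl⟩ := QuotientAddGroup.mk_surjective y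
  obtain ⟨g, z, hz, hg⟩ := exists_hurewicz_eq hX c
  have hc' : boundary X 0 c = 0 := hc
  rw [hc', map_zero, sub_zero] at hz
  exact ⟨g, hg.trans (by rw [show z = ⟨c, hc⟩ from Subtype.ext hz])⟩

end PosetHurewicz

theorem mainTheorem4 {X : Type*} [PartialOrder X] [Finite X] (x₀ : X) :
    (PosetHurewicz.hurewicz X x₀).ker = commutator (PosetHurewicz.Pi1 X x₀) ∧
    (ConnectedSpace (Topology.WithLowerSet X) →
      Function.Surjective (PosetHurewicz.hurewicz X x₀) ∧
      ∃ e : Abelianization (PosetHurewicz.Pi1 X x₀) ≃*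
          Multiplicative (PosetHurewicz.CubicalHomology X 1),
        ∀ a, e (Abelianization.of a) = PosetHurewicz.hurewicz X x₀ a) := by
  have hker := PosetHurewicz.ker_hurewicz x₀
  refine ⟨hker, fun hX => ?_⟩
  have hsurj := PosetHurewicz.hurewicz_surjective
    (PosetHurewicz.reachable_of_connected (x₀ := x₀) hX)
  refine ⟨hsurj, MulEquiv.ofBijective (Abelianization.lift (PosetHurewicz.hurewicz X x₀))
    ⟨?_, fun y => ?_⟩, fun a =>
      Abelianization.lift_apply_of (PosetHurewicz.hurewicz X x₀) a⟩
  · rw [injective_iff_map_eq_one]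
    intro x
    obtain ⟨g, rfl⟩ := QuotientGroup.mk_surjective x
    intro hg
    have hg' : g ∈ (PosetHurewicz.hurewicz X x₀).ker := hg
    rw [hker] at hg'
    exact (QuotientGroup.eq_one_iff g).2 hg'
  · obtain ⟨g, rfl⟩ := hsurj y
    exact ⟨Abelianization.of g, Abelianization.lift_apply_of _ g⟩
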